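/- Let $I=[\alpha,\beta]\subset\mathbb{R}$ with $\alpha<\beta$, and let $H\colon I\to\mathbb{C}^{N\times N}$ be a $C^\infty$ function with Hermitian values. Let $U(t,s)$, $t,s\in I$, be its propagator: $i\,\partial_t U(t,s)=H(t)U(t,s)$, $U(s,s)=\mathbb{1}$. Let $\|\cdot\|$ be the spectral norm. A product formula on $I$ is a finite ordered product $U_2(t,s)=\prod_l \exp\bigl(-i\,(t-s)\,G_l(s+\theta_l(t-s))\bigr)$ with each $G_l\colon I\to\mathbb{C}^{N\times N}$ smooth and Hermitian-valued and $\theta_l\in[0,1]$. It is symmetric if $U_2(t,s)^\dagger=U_2(s,t)$ for all $t,s\in I$. A map $V\colon I\times I\to\mathbb{C}^{N\times N}$ is an $n$-th order formula for $U$ if, for every $s\in I$, $\|V(t,s)-U(t,s)\|=O(|t-s|^{n+1})$ as $t\to s$ in $I$. Let $M\ge 1$, let $k_1,\dots,k_M$ be positive integers and let $a_1,\dots,a_M\in\mathbb{R}$ satisfy the Vandermonde system $\sum_j a_j=1$ and $\sum_j a_j k_j^{-2l}=0$ for $l=1,\dots,M-1$. For a base formula $U_2$ define the multiproduct formula $$U_{\vec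 k}(t,s)=\sum_{j=1}^M a_j\,U_2^{(k_j)}(t,s),\qquad U_2^{(k)}(t,s)=\prod_{q=1}^{k}U_2\Bigl(s+\tfrac{q}{k}(t-s),\,s+\tfrac{q-1}{k}(t-s)\Bigr),$$ where the product is time-ordered (latest time on the left). Theorem. The midpoint formula $\exp\bigl(-i\,(t-s)\,H(\tfrac{s+t}{2})\bigr)$ is a symmetric second-order product formula for $U$. For every symmetric second-order product formula $U_2$ for $U$, the multiproduct formula $U_{\vec k}$ built from $U_2$ is a $2M$-th order formula for $U$, that is, for every $t_0\in I$, $$\|U_{\vec k}(t,t_0)-U(t,t_0)\|=O(|t-t_0|^{2M+1})\qquad (t\to t_0,\ t\in I),$$ and it is unitary to one order better: for every $t_0\in I$, $$\|U_{\vec k}(t,t_0)^\dagger U_{\vec k}(t,t_0)-\mathbb{1}\|=O(|t-t_0|^{2M+2})\qquad (t\to t_0,\ t\in I).$$ -/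

import Mathlib

open scoped ContDiff Topology Matrix Matrix.Norms.L2Operator

namespace Multiproduct

variable {ι : Type*} [Fintype ι] [DecidableEq ι]

/-- `U t s` is the propagator (time evolution operator) from time `s` to time `t` generated by
`H` on the time interval `I`: for every initial time `s` in `I`, the function `t ↦ U t s` solves
`i ∂ₜ U(t, s) = H(t) U(t, s)`, `U(s, s) = 1`, on `I` (one-sided derivatives at end points). -/
def IsPropagator (I : Set ℝ) (H : ℝ → Matrix ι ι ℂ) (U : ℝ → ℝ → Matrix ι ι ℂ) : Prop :=
  ∀ s ∈ I, U s s = 1 ∧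
    ∀ t ∈ I, HasDerivWithinAt (fun τ => U τ s) (-Complex.I • (H t * U t s)) I t

/-- `V` is an `n`-th order formula for `U` on `I`: in the spectral norm,
`V(t, s) - U(t, s) = O((t - s)^(n + 1))` as `t → s` within `I`, for every initial time `s`. -/
def IsOrderFormula (n : ℕ) (I : Set ℝ) (U V : ℝ → ℝ → Matrix ι ι ℂ) : Prop :=
  ∀ s ∈ I, (fun t => ‖V t s - U t s‖) =O[𝓝[I] s] fun t => (t - s) ^ (n + 1)

/-- `V` is symmetric (under time reversal): `V(t, s)† = V(s, t)`. -/
def IsSymmetricFormula (I : Set ℝ) (V : ℝ → ℝ → Matrix ι ι ℂ) : Prop :=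
  ∀ t ∈ I, ∀ s ∈ I, (V t s)ᴴ = V s t

/-- The exponential `exp(-i G(s + θ (t - s)) (t - s))`. -/
noncomputable def stepExp (G : ℝ → Matrix ι ι ℂ) (θ t s : ℝ) : Matrix ι ι ℂ :=
  NormedSpace.exp ((-Complex.I * ((t - s : ℝ) : ℂ)) • G (s + θ * (t - s)))

/-- `V` is a product formula on `I`: a finite ordered product of exponentials
`exp(-i G(s + θ (t - s)) (t - s))`, where each `G` is a smooth Hermitian-valued function on `I`
(a term of the Hamiltonian, possibly rescaled) evaluated at an intermediate time,
`0 ≤ θ ≤ 1`. -/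
def IsProductFormula (I : Set ℝ) (V : ℝ → ℝ → Matrix ι ι ℂ) : Prop :=
  ∃ L : List ((ℝ → Matrix ι ι ℂ) × ℝ),
    (∀ p ∈ L, ContDiffOn ℝ ∞ p.1 I ∧ (∀ t ∈ I, (p.1 t).IsHermitian) ∧ p.2 ∈ Set.Icc (0 : ℝ) 1) ∧
    ∀ t ∈ I, ∀ s ∈ I, V t s = (L.map fun p => stepExp p.1 p.2 t s).prod

/-- The base formulas from which multiproduct formulas for `U` are built: symmetric second order
product formulas for `U`. -/
structure IsBaseFormula (I : Set ℝ) (U V : ℝ → ℝ → Matrix ι ι ℂ) : Prop where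
  isProductFormula : IsProductFormula I V
  isSymmetricFormula : IsSymmetricFormula I V
  isOrderFormula : IsOrderFormula 2 I U V

/-- The midpoint formula `U₂(t, s) = exp(-i H((s + t) / 2) (t - s))`. -/
noncomputable def midpointFormula (H : ℝ → Matrix ι ι ℂ) (t s : ℝ) : Matrix ι ι ℂ :=
  NormedSpace.exp ((-Complex.I * ((t - s : ℝ) : ℂ)) • H ((s + t) / 2))

/-- The `k`-step composition `V^(k)(t, s)`: the time-ordered product over `q = 1, …, k` (latest
time on the left) of `V(s + (t - s) q / k, s + (t - s) (q - 1) / k)`. -/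
noncomputable def iterate (V : ℝ → ℝ → Matrix ι ι ℂ) (k : ℕ) (t s : ℝ) : Matrix ι ι ℂ :=
  ((List.range k).map fun q : ℕ =>
    V (s + (t - s) * ((q + 1 : ℕ) : ℝ) / k) (s + (t - s) * (q : ℝ) / k)).reverse.prod

/-- The multiproduct formula `U_k(t, s) = ∑ⱼ aⱼ V^(kⱼ)(t, s)` with base formula `V`. -/
noncomputable def multiproduct {M : ℕ} (a : Fin M → ℝ) (k : Fin M → ℕ)
    (V : ℝ → ℝ → Matrix ι ι ℂ) (t s : ℝ) : Matrix ι ι ℂ :=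
  ∑ j, (a j : ℂ) • iterate V (k j) t s

/-- The Vandermonde system fixing the coefficients of a multiproduct formula with `M` terms:
`∑ⱼ aⱼ = 1` and `∑ⱼ aⱼ kⱼ^(-2l) = 0` for `l = 1, …, M - 1`. -/
def VandermondeSystem {M : ℕ} (a : Fin M → ℝ) (k : Fin M → ℕ) : Prop :=
  ∀ l < M, ∑ j, a j * ((k j : ℝ) ^ (2 * l))⁻¹ = if l = 0 then 1 else 0

end Multiproduct

/-! Fix the initial time `s`. A step of the base formula from `s + qδ` to `s + (q+1)δ` expands in
powers of δ with coefficients polynomial in q, of degree at most n - 1 at δ^n for n ≥ 1. Summing the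
resulting difference equation, k steps expand as ∑ c_{n,i} k^i δ^n with i ≤ n (`globalSeries`). With
δ = h/k, the coefficient of h^n is ∑ c_{n,i} k^(i-n).

The c_{n,n} satisfy the Taylor recursion of u' = A u, where A = -iH is the sum of the generators by
consistency, so the part independent of k is the expansion of the propagator
(`coeff_globalCoeff_self`, `hasExpansion_flowSeries`). Symmetry and unitarity make a reversed step
the inverse step, which forces c_{n,i} = 0 for n + i odd (`coeff_globalCoeff_eq_zero`): only even
powers of 1/k remain. Also c_{n,0} = 0 for n ≥ 1, since zero steps give the identity.

The Vandermonde system removes k^(-2l) for 1 ≤ l < M, and k^(-2M) first occurs at h^(2M+1), with i =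
1. This gives order 2M. The leading error is γ c_{2M+1,1} h^(2M+1) with γ real, and unitarity of k
steps for all k makes c_{n,1} skew-adjoint (`star_globalCoeff`), so this error cancels in the
unitarity defect. -/

namespace Multiproduct

/-! ### Polynomials and power series over a noncommutative real algebra. -/

section Algebra

open Polynomial PowerSeries

variable {R : Type*} [Ring R] [Algebra ℝ R]

/-- Evaluation of a polynomial over a (noncommutative) real algebra at a real number. -/
noncomputable def evalAt (x : ℝ) : R[X] →ₐ[ℝ] R :=
  Polynomial.eval₂AlgHom (AlgHom.id ℝ R) (algebraMap ℝ R x)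
    fun a => (Algebra.commutes x a).symm

lemma evalAt_C (x : ℝ) (a : R) : evalAt x (Polynomial.C a) = a := by
  simp [evalAt, Polynomial.eval₂AlgHom]

lemma evalAt_X (x : ℝ) : evalAt x (Polynomial.X : R[X]) = algebraMap ℝ R x := by
  simp [evalAt, Polynomial.eval₂AlgHom]

lemma evalAt_monomial (x : ℝ) (i : ℕ) (a : R) :
    evalAt x (Polynomial.monomial i a) = x ^ i • a := by
  rw [← Polynomial.C_mul_X_pow_eq_monomial, map_mul, map_pow, evalAt_C, evalAt_X, ← map_pow,
    ← Algebra.commutes, Algebra.smul_def]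

lemma evalAt_eq_sum {x : ℝ} {p : R[X]} {n : ℕ} (hp : p.natDegree < n) :
    evalAt x p = ∑ i ∈ Finset.range n, x ^ i • p.coeff i := by
  conv_lhs => rw [p.as_sum_range' n hp]
  simp [evalAt_monomial]

lemma evalAt_trunc (x : ℝ) (n : ℕ) (P : R⟦X⟧) :
    evalAt x (P.trunc n) = ∑ i ∈ Finset.range n, x ^ i • PowerSeries.coeff i P := by
  rw [PowerSeries.trunc_apply, ← Finset.range_eq_Ico]
  simp [evalAt_monomial]

/-- Coefficientwise evaluation of a power series with polynomial coefficients. -/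
noncomputable def evalSeries (x : ℝ) : R[X]⟦X⟧ →+* R⟦X⟧ :=
  PowerSeries.map (evalAt x : R[X] →ₐ[ℝ] R).toRingHom

lemma coeff_evalSeries (x : ℝ) (F : R[X]⟦X⟧) (n : ℕ) :
    PowerSeries.coeff n (evalSeries x F) = evalAt x (PowerSeries.coeff n F) := by
  simp [evalSeries]

/-- A polynomial over a real algebra that vanishes at all natural numbers is zero. -/
lemma eq_zero_of_forall_evalAt_natCast {p : R[X]} (hp : ∀ k : ℕ, evalAt (k : ℝ) p = 0) :
    p = 0 := by
  ext i
  -- Linear functionals separate points, and each one turns `p` into a real polynomial with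
  -- infinitely many roots.
  rw [Polynomial.coeff_zero, ← Module.forall_dual_apply_eq_zero_iff ℝ]
  intro φ
  set r : ℝ[X] := ∑ i ∈ Finset.range (p.natDegree + 1), Polynomial.monomial i (φ (p.coeff i))
    with hr
  have hr0 : r = 0 := by
    apply Polynomial.eq_zero_of_infinite_isRoot
    apply Set.infinite_of_injective_forall_mem (f := fun k : ℕ => (k : ℝ)) Nat.cast_injective
    intro k
    have := congrArg φ (hp k)
    rw [evalAt_eq_sum (Nat.lt_succ_self _), map_sum, map_zero] at this
    simp only [Set.mem_ofPred_eq, Polynomial.IsRoot, hr, Polynomial.eval_finsetSum,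
      Polynomial.eval_monomial]
    rw [← this]
    exact Finset.sum_congr rfl fun i _ => by rw [map_smul, smul_eq_mul, mul_comm]
  have hc := congrArg (fun s => Polynomial.coeff s i) hr0
  simp only [hr, Polynomial.finsetSum_coeff, Polynomial.coeff_monomial, Polynomial.coeff_zero,
    Finset.sum_ite_eq', Finset.mem_range] at hc
  split_ifs at hc with h
  · exact hc
  · rw [Polynomial.coeff_eq_zero_of_natDegree_lt (by omega), map_zero]

/-- The substitution `X ↦ c X` in a power series over a real algebra. -/
noncomputable def scale (c : ℝ) : R⟦X⟧ →+* R⟦X⟧ where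
  toFun P := PowerSeries.mk fun n => c ^ n • PowerSeries.coeff n P
  map_zero' := by ext; simp
  map_one' := by
    ext n
    by_cases h : n = 0 <;> simp [PowerSeries.coeff_one, h]
  map_add' P Q := by ext; simp
  map_mul' P Q := by
    ext n
    simp only [PowerSeries.coeff_mk, PowerSeries.coeff_mul, Finset.smul_sum]
    refine Finset.sum_congr rfl fun x hx => ?_
    rw [smul_mul_smul_comm, ← pow_add, Finset.HasAntidiagonal.mem_antidiagonal.1 hx]

lemma coeff_scale (c : ℝ) (P : R⟦X⟧) (n : ℕ) :
    PowerSeries.coeff n (scale c P) = c ^ n • PowerSeries.coeff n P := by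
  simp [scale]

lemma scale_scale (c d : ℝ) (P : R⟦X⟧) : scale c (scale d P) = scale (c * d) P := by
  ext n
  simp [coeff_scale, mul_pow, smul_smul]

lemma scale_X (c : ℝ) : scale c (PowerSeries.X : R⟦X⟧) = c • PowerSeries.X := by
  ext n
  by_cases h : n = 1 <;> simp [coeff_scale, PowerSeries.coeff_X, h]

/-- The exponential of a power series without constant term. -/
noncomputable def expOf (Y : R⟦X⟧) : R⟦X⟧ :=
  PowerSeries.mk fun n =>
    ∑ j ∈ Finset.range (n + 1), ((j.factorial : ℝ)⁻¹) • PowerSeries.coeff n (Y ^ j)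

lemma coeff_expOf (Y : R⟦X⟧) (n : ℕ) : PowerSeries.coeff n (expOf Y) =
    ∑ j ∈ Finset.range (n + 1), ((j.factorial : ℝ)⁻¹) • PowerSeries.coeff n (Y ^ j) := by
  simp [expOf]

/-- Hence the sum in `expOf`, cut at `j = n`, omits only zero terms when its argument is a multiple
of `X`. -/
lemma coeff_pow_eq_zero {S : Type*} [Semiring S] {Y : S⟦X⟧} {n j : ℕ} (h : n < j) :
    PowerSeries.coeff n ((PowerSeries.X * Y) ^ j) = 0 := by
  rw [(PowerSeries.commute_X Y).symm.mul_pow, PowerSeries.coeff_X_pow_mul', if_neg (by omega)]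

lemma evalSeries_expOf (x : ℝ) (Y : R[X]⟦X⟧) :
    evalSeries x (expOf Y) = expOf (evalSeries x Y) := by
  ext n
  simp only [coeff_evalSeries, coeff_expOf, map_sum, ← map_pow, map_smul]

lemma scale_expOf (c : ℝ) (Y : R⟦X⟧) : scale c (expOf Y) = expOf (scale c Y) := by
  ext n
  simp only [coeff_scale, coeff_expOf, ← map_pow, Finset.smul_sum]
  exact Finset.sum_congr rfl fun j _ => smul_comm _ _ _

end Algebra

/-! ### Calculus of asymptotic expansions at 0. -/

section Expansion

open Asymptotics Filter Finset

variable {𝔸 : Type*} [NormedRing 𝔸] [NormedAlgebra ℝ 𝔸] {l : Filter ℝ}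

/-- The power series `P` is the asymptotic expansion of `f` at `0` along the filter `l`. -/
def HasExpansion (l : Filter ℝ) (f : ℝ → 𝔸) (P : PowerSeries 𝔸) : Prop :=
  ∀ n : ℕ, (fun h => f h - ∑ i ∈ range n, h ^ i • PowerSeries.coeff i P) =O[l] fun h => h ^ n

lemma pow_isBigO_pow (hl : l ≤ 𝓝 0) {m n : ℕ} (h : n ≤ m) :
    (fun x : ℝ => x ^ m) =O[l] fun x => x ^ n := by
  have h1 : (fun x : ℝ => x ^ (m - n)) =O[l] fun _ => (1 : ℝ) :=
    ((continuous_pow (m - n)).tendsto 0).mono_left hl |>.isBigO_one ℝ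
  refine ((isBigO_refl (fun x : ℝ => x ^ n) l).mul h1).congr (fun x => ?_) fun x => mul_one _
  rw [← pow_add, Nat.add_sub_cancel' h]

lemma pow_smul_isBigO (a : 𝔸) (n : ℕ) : (fun x : ℝ => x ^ n • a) =O[l] fun x => x ^ n :=
  IsBigO.of_bound ‖a‖ <| Eventually.of_forall fun x => by rw [norm_smul, mul_comm]

lemma evalAt_isBigO (hl : l ≤ 𝓝 0) {p : Polynomial 𝔸} {n : ℕ}
    (hp : ∀ i < n, p.coeff i = 0) : (fun x => evalAt x p) =O[l] fun x => x ^ n := by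
  simp_rw [evalAt_eq_sum (Nat.lt_succ_self p.natDegree)]
  refine IsBigO.fun_sum fun i _ => ?_
  by_cases h : i < n
  · simpa [hp i h] using isBigO_zero _ _
  · exact (pow_smul_isBigO _ _).trans (pow_isBigO_pow hl (not_lt.1 h))

namespace HasExpansion

variable {f g : ℝ → 𝔸} {P Q : PowerSeries 𝔸}

lemma isBigO_one (hf : HasExpansion l f P) : f =O[l] fun _ => (1 : ℝ) := by
  simpa using hf 0

lemma congr (hf : HasExpansion l f P) (h : f =ᶠ[l] g) : HasExpansion l g P := fun n =>
  (hf n).congr' (h.mono fun x hx => by simp only [hx]) EventuallyEq.rfl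

lemma const (a : 𝔸) : HasExpansion l (fun _ => a) (PowerSeries.C a) := by
  intro n
  cases n with
  | zero => simpa using isBigO_const_const a (one_ne_zero (α := ℝ)) l
  | succ n =>
    have : (fun h : ℝ => a - ∑ i ∈ range (n + 1), h ^ i • PowerSeries.coeff i (PowerSeries.C a))
        = fun _ => 0 := by
      funext h
      rw [sum_range_succ', sum_eq_zero]
      · simp
      · intro i _
        simp
    rw [this]
    exact isBigO_zero _ _

lemma one : HasExpansion l (fun _ => (1 : 𝔸)) 1 := by
  simpa using const (l := l) (1 : 𝔸)

lemma zero : HasExpansion l (fun _ => (0 : 𝔸)) 0 := by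
  simpa using const (l := l) (0 : 𝔸)

lemma add (hf : HasExpansion l f P) (hg : HasExpansion l g Q) :
    HasExpansion l (fun h => f h + g h) (P + Q) := fun n =>
  ((hf n).add (hg n)).congr_left fun h => by
    simp only [map_add, smul_add, sum_add_distrib]
    abel

lemma const_smul (c : ℝ) (hf : HasExpansion l f P) :
    HasExpansion l (fun h => c • f h) (c • P) := fun n =>
  ((hf n).const_smul_left c).congr_left fun h => by
    simp only [PowerSeries.coeff_smul, smul_sub, smul_sum, smul_comm c, Pi.smul_apply]

lemma neg (hf : HasExpansion l f P) : HasExpansion l (fun h => - f h) (- P) := by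
  simpa using hf.const_smul (-1)

lemma sub (hf : HasExpansion l f P) (hg : HasExpansion l g Q) :
    HasExpansion l (fun h => f h - g h) (P - Q) := by
  simpa only [sub_eq_add_neg] using hf.add hg.neg

lemma sum {σ : Type*} {s : Finset σ} {f : σ → ℝ → 𝔸} {P : σ → PowerSeries 𝔸}
    (h : ∀ i ∈ s, HasExpansion l (f i) (P i)) :
    HasExpansion l (fun x => ∑ i ∈ s, f i x) (∑ i ∈ s, P i) := by
  classical
  induction s using Finset.induction_on with
  | empty => simpa using zero
  | insert a s ha ih =>
    simp only [sum_insert ha]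
    exact (h a (mem_insert_self _ _)).add (ih fun i hi => h i (mem_insert_of_mem hi))

lemma smul_id (hl : l ≤ 𝓝 0) (hf : HasExpansion l f P) :
    HasExpansion l (fun h => h • f h) (PowerSeries.X * P) := by
  intro n
  have hid : (fun h : ℝ => h) =O[l] fun h => h := isBigO_refl _ _
  cases n with
  | zero =>
    have h1 : (fun h : ℝ => h) =O[l] fun _ => (1 : ℝ) := by
      simpa using pow_isBigO_pow hl (Nat.zero_le 1)
    simpa using h1.smul hf.isBigO_one
  | succ n =>
    refine (hid.smul (hf n)).congr (fun h => ?_) fun h => by simp [pow_succ']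
    rw [sum_range_succ', smul_sub, smul_sum]
    simp [PowerSeries.coeff_succ_X_mul, pow_succ', smul_smul]

lemma mul (hl : l ≤ 𝓝 0) (hf : HasExpansion l f P) (hg : HasExpansion l g Q) :
    HasExpansion l (fun h => f h * g h) (P * Q) := by
  intro n
  -- With p, q the truncations, the remainder is (f - p) g + p (g - q) + (p q - trunc (P Q)).
  have e1 := (hf n).mul hg.isBigO_one
  have e2 := (evalAt_isBigO (n := 0) hl (p := P.trunc n) (by simp)).mul (hg n)
  have e3 : (fun x => evalAt x (P.trunc n * Q.trunc n - (P * Q).trunc n)) =O[l]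
      fun x => x ^ n := by
    refine evalAt_isBigO hl fun i hi => ?_
    rw [Polynomial.coeff_sub, PowerSeries.coeff_trunc, if_pos hi, Polynomial.coeff_mul,
      PowerSeries.coeff_mul, sub_eq_zero]
    refine Finset.sum_congr rfl fun x hx => ?_
    have := Finset.HasAntidiagonal.mem_antidiagonal.1 hx
    rw [PowerSeries.coeff_trunc, PowerSeries.coeff_trunc, if_pos (by omega), if_pos (by omega)]
  simp only [pow_zero, one_mul, mul_one] at e1 e2
  refine ((e1.add e2).add e3).congr_left fun h => ?_
  simp only [← evalAt_trunc, map_sub, map_mul]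
  noncomm_ring

lemma pow (hl : l ≤ 𝓝 0) (hf : HasExpansion l f P) (n : ℕ) :
    HasExpansion l (fun h => f h ^ n) (P ^ n) := by
  induction n with
  | zero => simpa using one
  | succ n ih =>
    simp only [pow_succ]
    exact ih.mul hl hf

lemma list_prod (hl : l ≤ 𝓝 0) {σ : Type*} (L : List σ) {f : σ → ℝ → 𝔸}
    {P : σ → PowerSeries 𝔸} (h : ∀ i ∈ L, HasExpansion l (f i) (P i)) :
    HasExpansion l (fun x => (L.map fun i => f i x).prod) (L.map P).prod := by
  induction L with
  | nil => simpa using one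
  | cons a L ih =>
    simp only [List.map_cons, List.prod_cons]
    exact (h a (by simp)).mul hl (ih fun i hi => h i (by simp [hi]))

lemma list_sum {σ : Type*} (L : List σ) {f : σ → ℝ → 𝔸} {P : σ → PowerSeries 𝔸}
    (h : ∀ i ∈ L, HasExpansion l (f i) (P i)) :
    HasExpansion l (fun x => (L.map fun i => f i x).sum) (L.map P).sum := by
  induction L with
  | nil => simpa using zero
  | cons a L ih =>
    simp only [List.map_cons, List.sum_cons]
    exact (h a (by simp)).add (ih fun i hi => h i (by simp [hi]))

lemma comp_mul_left {c : ℝ} (hc : Tendsto (c * ·) l l) (hf : HasExpansion l f P) :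
    HasExpansion l (fun h => f (c * h)) (scale c P) := by
  intro n
  have h1 := (hf n).comp_tendsto hc
  have h2 : ((fun h : ℝ => h ^ n) ∘ fun h => c * h) =O[l] fun h => h ^ n :=
    ((isBigO_refl (fun h : ℝ => h ^ n) l).const_mul_left (c ^ n)).congr_left fun h => by
      simp [mul_pow]
  refine (h1.trans h2).congr_left fun h => ?_
  simp only [Function.comp, coeff_scale, mul_pow, smul_smul, mul_comm]

lemma exp [CompleteSpace 𝔸] (hl : l ≤ 𝓝 0) (hf : HasExpansion l f P) :
    HasExpansion l (fun h => NormedSpace.exp (h • f h)) (expOf (PowerSeries.X * P)) := by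
  intro n
  have hX := hf.smul_id hl
  have hO : (fun h => h • f h) =O[l] fun h => h := by simpa using hX 1
  have h0 : Tendsto (fun h => h • f h) l (𝓝 0) := hO.trans_tendsto hl
  have hs : HasExpansion l
      (fun h => ∑ j ∈ range n, ((j.factorial : ℝ)⁻¹) • (h • f h) ^ j)
      (∑ j ∈ range n, ((j.factorial : ℝ)⁻¹) • (PowerSeries.X * P) ^ j) :=
    HasExpansion.sum fun j _ => (hX.pow hl j).const_smul _
  have hexp := ((NormedSpace.exp_hasFPowerSeriesAt_zero (𝕂 := ℝ)
    (𝔸 := 𝔸)).isBigO_sub_partialSum_pow n).comp_tendsto h0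
  have hexp' : (fun h => NormedSpace.exp (h • f h)
      - ∑ j ∈ range n, ((j.factorial : ℝ)⁻¹) • (h • f h) ^ j) =O[l] fun h => h ^ n := by
    refine (hexp.congr_left fun h => ?_).trans (hO.norm_left.pow n)
    simp only [Function.comp, zero_add, FormalMultilinearSeries.partialSum,
      NormedSpace.expSeries_apply_eq]
  refine (hexp'.add (hs n)).congr_left fun h => ?_
  -- The powers j > i contribute nothing in degree i, so cutting at j < n or at j ≤ i gives the same
  -- coefficient.
  have : ∀ i ∈ range n, PowerSeries.coeff i (expOf (PowerSeries.X * P)) = PowerSeries.coeff i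
      (∑ j ∈ range n, ((j.factorial : ℝ)⁻¹) • (PowerSeries.X * P) ^ j) := by
    intro i hi
    rw [coeff_expOf, map_sum]
    simp only [PowerSeries.coeff_smul]
    refine Finset.sum_subset (range_subset_range.2 (by simp at hi; omega)) fun j _ hj => ?_
    rw [coeff_pow_eq_zero (by simp at hj; omega), smul_zero]
  rw [Finset.sum_congr (s₁ := range n) rfl fun i hi => congrArg (h ^ i • ·) (this i hi)]
  abel

lemma star [StarRing 𝔸] [NormedStarGroup 𝔸] [StarModule ℝ 𝔸] (hf : HasExpansion l f P) :
    HasExpansion l (fun h => star (f h))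
      (PowerSeries.mk fun n => Star.star (PowerSeries.coeff n P)) := by
  intro n
  refine (IsBigO.of_norm_left ((hf n).norm_left.congr_left fun h => ?_))
  rw [← norm_star]
  simp [star_sum]

lemma coeff_eq_zero [(l ⊓ 𝓟 {0}ᶜ).NeBot] (hl : l ≤ 𝓝 0) (hf : HasExpansion l f P) {n : ℕ}
    (hO : f =O[l] fun h => h ^ n) : ∀ i < n, PowerSeries.coeff i P = 0 := by
  intro i
  induction i using Nat.strong_induction_on with
  | _ i ih =>
  intro hi
  have h1 := hf (i + 1)
  have h2 : (fun h : ℝ => h ^ i • PowerSeries.coeff i P) =O[l] fun h => h ^ (i + 1) := by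
    refine ((hO.trans (pow_isBigO_pow hl hi)).sub h1).congr_left fun h => ?_
    rw [sum_range_succ, sum_eq_zero fun j hj => by
      rw [ih j (by simpa using hj) (by simp at hj; omega), smul_zero]]
    abel
  -- Dividing by h^i requires h ≠ 0, hence the punctured filter.
  have h3 : (fun _ : ℝ => PowerSeries.coeff i P) =O[l ⊓ 𝓟 {0}ᶜ] fun h => h := by
    obtain ⟨c, hc⟩ := h2.bound
    refine IsBigO.of_bound c ?_
    filter_upwards [hc.filter_mono inf_le_left, mem_inf_of_right (mem_principal_self _)]
      with h hh h0
    have h0' : 0 < ‖h ^ i‖ := by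
      exact norm_pos_iff.2 (pow_ne_zero i h0)
    rw [norm_smul, pow_succ, norm_mul] at hh
    exact le_of_mul_le_mul_left (by linarith) h0'
  have h4 : Tendsto (fun _ : ℝ => PowerSeries.coeff i P) (l ⊓ 𝓟 {0}ᶜ) (𝓝 0) :=
    h3.trans_tendsto (le_trans inf_le_left hl)
  exact (tendsto_nhds_unique h4 tendsto_const_nhds).symm

lemma coeff_eq [(l ⊓ 𝓟 {0}ᶜ).NeBot] (hl : l ≤ 𝓝 0) (hf : HasExpansion l f P)
    (hg : HasExpansion l g Q) {n : ℕ} (hO : (fun h => f h - g h) =O[l] fun h => h ^ n) :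
    ∀ i < n, PowerSeries.coeff i P = PowerSeries.coeff i Q := fun i hi => by
  simpa [sub_eq_zero] using (hf.sub hg).coeff_eq_zero hl hO i hi

lemma unique [(l ⊓ 𝓟 {0}ᶜ).NeBot] (hl : l ≤ 𝓝 0) (hf : HasExpansion l f P)
    (hg : HasExpansion l f Q) : P = Q := by
  ext i
  exact hf.coeff_eq hl hg (n := i + 1) (by simpa using isBigO_zero _ _) i (Nat.lt_succ_self i)

lemma isBigO_of_coeff_eq_zero (hf : HasExpansion l f P) {n : ℕ}
    (h : ∀ i < n, PowerSeries.coeff i P = 0) : f =O[l] fun h => h ^ n :=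
  (hf n).congr_left fun x => by
    rw [sum_eq_zero fun i hi => by rw [h i (by simpa using hi), smul_zero], sub_zero]

end HasExpansion

end Expansion

/-! ### Degrees in the step number and leading coefficients. -/

section Graded

open Polynomial PowerSeries Finset

variable {R : Type*} [Ring R]

/-- The `n`-th coefficient of the power series `F` is a polynomial of degree at most `n - 1`. -/
def IsGraded (F : R[X]⟦X⟧) : Prop := ∀ n, (PowerSeries.coeff n F).natDegree ≤ n - 1

/-- The coefficient of degree `n` of the `(n + 1)`-st coefficient of a power series. -/
noncomputable def topCoeff (F : R[X]⟦X⟧) (n : ℕ) : R :=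
  (PowerSeries.coeff (n + 1) F).coeff n

namespace IsGraded

variable {F G : R[X]⟦X⟧}

lemma one : IsGraded (1 : R[X]⟦X⟧) := fun n => by
  rw [PowerSeries.coeff_one]
  split_ifs <;> simp

lemma mul (hF : IsGraded F) (hG : IsGraded G) : IsGraded (F * G) := fun n => by
  rw [PowerSeries.coeff_mul]
  refine Polynomial.natDegree_sum_le_of_forall_le _ _ fun x hx => ?_
  have := HasAntidiagonal.mem_antidiagonal.1 hx
  have h1 := hF x.1
  have h2 := hG x.2
  exact Polynomial.natDegree_mul_le.trans (by omega)

lemma pow (hF : IsGraded F) (n : ℕ) : IsGraded (F ^ n) := by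
  induction n with
  | zero => simpa using one
  | succ n ih => exact pow_succ F n ▸ ih.mul hF

lemma list_prod (L : List R[X]⟦X⟧) (h : ∀ F ∈ L, IsGraded F) : IsGraded L.prod := by
  induction L with
  | nil => simpa using one
  | cons a L ih =>
    rw [List.prod_cons]
    exact (h a (by simp)).mul (ih fun i hi => h i (by simp [hi]))

/-- A product of coefficients of positive indices i + j = n + 1 has degree at most (i - 1) + (j - 1)
= n - 1, so only the two end terms reach degree n. Thus `topCoeff` is additive on products of graded
series with constant coefficient 1. -/
lemma topCoeff_mul (hF : IsGraded F) (hG : IsGraded G) (n : ℕ) :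
    topCoeff (F * G) n = (PowerSeries.coeff 0 F).coeff 0 * topCoeff G n
      + topCoeff F n * (PowerSeries.coeff 0 G).coeff 0 := by
  have hF0 := hF 0
  have hG0 := hG 0
  have hFn := hF (n + 1)
  have hGn := hG (n + 1)
  simp only [add_tsub_cancel_right] at hFn hGn
  have hfirst := Polynomial.coeff_mul_add_eq_of_natDegree_le (df := 0) hF0 hGn
  rw [zero_add] at hfirst
  rw [topCoeff, PowerSeries.coeff_mul, Finset.Nat.sum_antidiagonal_succ,
    Polynomial.coeff_add, hfirst]
  congr 1
  cases n with
  | zero => simp [topCoeff]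
  | succ n =>
    have hlast := Polynomial.coeff_mul_add_eq_of_natDegree_le (dg := 0) hFn hG0
    rw [add_zero] at hlast
    rw [Finset.Nat.sum_antidiagonal_succ', Polynomial.coeff_add, hlast,
      Polynomial.finsetSum_coeff, Finset.sum_eq_zero, add_zero]
    · rfl
    · intro x hx
      have := HasAntidiagonal.mem_antidiagonal.1 hx
      have h1 := hF (x.1 + 1)
      have h2 := hG (x.2 + 1)
      exact Polynomial.coeff_eq_zero_of_natDegree_lt
        (lt_of_le_of_lt Polynomial.natDegree_mul_le (by dsimp only at h1 h2 ⊢; omega))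

variable [Algebra ℝ R]

lemma expOf (hF : IsGraded F) : IsGraded (Multiproduct.expOf F) := fun n => by
  rw [coeff_expOf]
  exact Polynomial.natDegree_sum_le_of_forall_le _ _ fun j _ =>
    (Polynomial.natDegree_smul_le _ _).trans (hF.pow j n)

end IsGraded

variable [Algebra ℝ R]

/-- The power series in `X` (a time step) with coefficients polynomials in `q` (the number of the
step) that represents `a((q + θ) X)`. -/
noncomputable def affineSeries (a : R⟦X⟧) (θ : ℝ) : R[X]⟦X⟧ :=
  PowerSeries.mk fun r => Polynomial.C (PowerSeries.coeff r a)
    * (Polynomial.X + Polynomial.C (algebraMap ℝ R θ)) ^ r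

/-- The power series that represents `exp(X a((q + θ) X))`. -/
noncomputable def stepSeries (a : R⟦X⟧) (θ : ℝ) : R[X]⟦X⟧ :=
  expOf (PowerSeries.X * affineSeries a θ)

/-- The power series that represents a step of a product formula. -/
noncomputable def baseSeries (L : List (R⟦X⟧ × ℝ)) : R[X]⟦X⟧ :=
  (L.map fun p => stepSeries p.1 p.2).prod

lemma natDegree_X_add_C_pow_le {S : Type*} [Semiring S] (c : S) (n : ℕ) :
    ((Polynomial.X + Polynomial.C c) ^ n).natDegree ≤ n :=
  (Polynomial.natDegree_pow_le_of_le n (Polynomial.natDegree_add_le_of_degree_le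
    Polynomial.natDegree_X_le ((Polynomial.natDegree_C c).le.trans zero_le_one))).trans_eq (mul_one n)

lemma coeff_X_add_C_pow_self {S : Type*} [Semiring S] (c : S) (n : ℕ) :
    ((Polynomial.X + Polynomial.C c) ^ n).coeff n = 1 := by
  rw [Polynomial.coeff_X_add_C_pow]
  simp

lemma isGraded_X_mul_affineSeries (a : R⟦X⟧) (θ : ℝ) :
    IsGraded (PowerSeries.X * affineSeries a θ) := by
  intro n
  cases n with
  | zero => simp
  | succ n =>
    rw [PowerSeries.coeff_succ_X_mul, affineSeries, PowerSeries.coeff_mk]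
    exact (Polynomial.natDegree_C_mul_le _ _).trans (natDegree_X_add_C_pow_le _ _)

lemma isGraded_stepSeries (a : R⟦X⟧) (θ : ℝ) : IsGraded (stepSeries a θ) :=
  (isGraded_X_mul_affineSeries a θ).expOf

lemma isGraded_baseSeries (L : List (R⟦X⟧ × ℝ)) : IsGraded (baseSeries L) :=
  IsGraded.list_prod _ fun F hF => by
    obtain ⟨p, _, rfl⟩ := List.mem_map.1 hF
    exact isGraded_stepSeries _ _

lemma coeff_zero_expOf (Y : R⟦X⟧) : PowerSeries.coeff 0 (expOf Y) = 1 := by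
  simp [coeff_expOf]

lemma coeff_zero_baseSeries (L : List (R⟦X⟧ × ℝ)) : PowerSeries.coeff 0 (baseSeries L) = 1 := by
  rw [baseSeries, PowerSeries.coeff_zero_eq_constantCoeff_apply, map_list_prod]
  refine List.prod_eq_one fun x hx => ?_
  simp only [List.map_map, List.mem_map] at hx
  obtain ⟨p, _, rfl⟩ := hx
  simpa [stepSeries] using coeff_zero_expOf (PowerSeries.X * affineSeries p.1 p.2)

lemma topCoeff_X_mul_affineSeries (a : R⟦X⟧) (θ : ℝ) (n : ℕ) :
    topCoeff (PowerSeries.X * affineSeries a θ) n = PowerSeries.coeff n a := by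
  rw [topCoeff, PowerSeries.coeff_succ_X_mul, affineSeries, PowerSeries.coeff_mk,
    Polynomial.coeff_C_mul, coeff_X_add_C_pow_self, mul_one]

/-- Only the linear term of the exponential counts: by `topCoeff_mul`, a product of two graded
series without constant term has no top coefficient. The shift θ drops out because (q + θ)^n is
monic in q. -/
lemma topCoeff_stepSeries (a : R⟦X⟧) (θ : ℝ) (n : ℕ) :
    topCoeff (stepSeries a θ) n = PowerSeries.coeff n a := by
  have hY := isGraded_X_mul_affineSeries a θ
  rw [topCoeff, stepSeries, coeff_expOf, Polynomial.finsetSum_coeff,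
    Finset.sum_eq_single_of_mem 1 (by simp)]
  · simpa [topCoeff] using topCoeff_X_mul_affineSeries a θ n
  · intro j _ hj
    rw [Polynomial.coeff_smul]
    rcases j with _ | _ | j
    · simp [PowerSeries.coeff_one]
    · exact absurd rfl hj
    · have := (hY.pow (j + 1)).topCoeff_mul hY n
      rw [← pow_succ, coeff_pow_eq_zero (Nat.succ_pos j)] at this
      rw [← topCoeff, this]
      simp

lemma topCoeff_baseSeries (L : List (R⟦X⟧ × ℝ)) (n : ℕ) :
    topCoeff (baseSeries L) n = (L.map fun p => PowerSeries.coeff n p.1).sum := by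
  induction L with
  | nil => simp [baseSeries, topCoeff, PowerSeries.coeff_one]
  | cons p L ih =>
    have h1 : baseSeries (p :: L) = stepSeries p.1 p.2 * baseSeries L := by simp [baseSeries]
    rw [h1, (isGraded_stepSeries _ _).topCoeff_mul (isGraded_baseSeries L), ih,
      coeff_zero_baseSeries, topCoeff_stepSeries, stepSeries, coeff_zero_expOf]
    simp [add_comm]

lemma evalSeries_affineSeries (a : R⟦X⟧) (θ q : ℝ) :
    evalSeries q (affineSeries a θ) = scale (q + θ) a := by
  ext n
  simp only [coeff_evalSeries, affineSeries, PowerSeries.coeff_mk, coeff_scale,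
    map_mul, map_pow, map_add, evalAt_C, evalAt_X]
  rw [← map_add, ← map_pow, ← Algebra.commutes, Algebra.smul_def]

lemma evalSeries_X (q : ℝ) : evalSeries q (PowerSeries.X : R[X]⟦X⟧) = PowerSeries.X := by
  simp [evalSeries]

lemma evalSeries_stepSeries (a : R⟦X⟧) (θ q : ℝ) :
    evalSeries q (stepSeries a θ)
      = expOf (PowerSeries.X * scale (q + θ) a) := by
  rw [stepSeries, evalSeries_expOf, map_mul, evalSeries_affineSeries, evalSeries_X]

lemma evalSeries_baseSeries (L : List (R⟦X⟧ × ℝ)) (q : ℝ) :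
    evalSeries q (baseSeries L)
      = (L.map fun p => expOf (PowerSeries.X * scale (q + p.2) p.1)).prod := by
  rw [baseSeries, map_list_prod, List.map_map]
  congr 1
  exact List.map_congr_left fun p _ => evalSeries_stepSeries _ _ _

end Graded

/-! ### Polynomial antidifferences. -/

section Antidifference

open Polynomial

/-- The witness is (B_{r+1}(x) - B_{r+1}(0)) / (r + 1), with B the Bernoulli polynomials. -/
lemma exists_powSum (r : ℕ) : ∃ s : ℝ[X], s.natDegree ≤ r + 1 ∧
    s.coeff (r + 1) = ((r + 1 : ℕ) : ℝ)⁻¹ ∧ s.eval 0 = 0 ∧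
    ∀ x : ℝ, s.eval (x + 1) = s.eval x + x ^ r := by
  set b : ℝ[X] := (Polynomial.bernoulli (r + 1)).map (algebraMap ℚ ℝ) with hb
  have hdeg : b.natDegree ≤ r + 1 := by
    refine Polynomial.natDegree_map_le.trans ?_
    rw [Polynomial.natDegree_le_iff_coeff_eq_zero]
    intro N hN
    rw [Polynomial.coeff_bernoulli, if_neg (by omega)]
  have hcoeff : b.coeff (r + 1) = 1 := by
    simp [hb, Polynomial.coeff_bernoulli]
  have hstep : ∀ x : ℝ, b.eval (x + 1) = b.eval x + ((r + 1 : ℕ) : ℝ) * x ^ r := by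
    intro x
    have h := congrArg (fun p => (p.map (algebraMap ℚ ℝ)).eval x)
      (Polynomial.bernoulli_comp_one_add_X (r + 1))
    simp [Polynomial.map_comp] at h
    rw [add_comm x 1, hb, Polynomial.eval_map_algebraMap, Polynomial.eval_map_algebraMap, h]
    push_cast
    ring
  have hr : ((r + 1 : ℕ) : ℝ) ≠ 0 := by positivity
  refine ⟨((r + 1 : ℕ) : ℝ)⁻¹ • (b - C (b.eval 0)), ?_, ?_, ?_, fun x => ?_⟩
  · refine (Polynomial.natDegree_smul_le _ _).trans ?_
    rw [Polynomial.natDegree_sub_C]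
    exact hdeg
  · rw [Polynomial.coeff_smul, Polynomial.coeff_sub, hcoeff, Polynomial.coeff_C_succ]
    simp
  · simp
  · simp only [Polynomial.eval_smul, Polynomial.eval_sub, Polynomial.eval_C, hstep, smul_eq_mul]
    field_simp
    ring

variable {R : Type*} [Ring R] [Algebra ℝ R]

lemma evalAt_map_mul_C (x : ℝ) (s : ℝ[X]) (a : R) :
    evalAt x (s.map (algebraMap ℝ R) * C a) = s.eval x • a := by
  rw [map_mul, evalAt_C, Algebra.smul_def]
  congr 1
  induction s using Polynomial.induction_on' with
  | add p q hp hq => simp [hp, hq]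
  | monomial n c =>
    rw [Polynomial.map_monomial, evalAt_monomial, Polynomial.eval_monomial, Algebra.smul_def,
      ← map_mul, mul_comm]

lemma exists_antidifference (p : R[X]) : ∃ q : R[X], evalAt 0 q = 0 ∧
    (∀ x : ℝ, evalAt (x + 1) q = evalAt x q + evalAt x p) ∧
    ∀ n, p.natDegree ≤ n → q.natDegree ≤ n + 1 ∧
      ((n + 1 : ℕ) : ℝ) • q.coeff (n + 1) = p.coeff n := by
  choose s hsdeg hscoeff hs0 hs using exists_powSum
  refine ⟨∑ r ∈ Finset.range (p.natDegree + 1), (s r).map (algebraMap ℝ R) * C (p.coeff r),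
    ?_, fun x => ?_, fun n hn => ⟨?_, ?_⟩⟩
  · simp [evalAt_map_mul_C, hs0]
  · rw [evalAt_eq_sum (Nat.lt_succ_self p.natDegree)]
    simp [evalAt_map_mul_C, hs, add_smul, Finset.sum_add_distrib]
  · refine Polynomial.natDegree_sum_le_of_forall_le _ _ fun r hr => ?_
    have h1 := hsdeg r
    have h2 : r ≤ p.natDegree := by simpa [Nat.lt_succ_iff] using hr
    exact (Polynomial.natDegree_mul_C_le _ _).trans
      (Polynomial.natDegree_map_le.trans (by omega))
  · have hterm : ∀ r ≠ n, r ∈ Finset.range (p.natDegree + 1) →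
        ((s r).map (algebraMap ℝ R) * C (p.coeff r)).coeff (n + 1) = 0 := by
      intro r hr hr'
      have h1 := hsdeg r
      have h2 : r ≤ p.natDegree := by simpa [Nat.lt_succ_iff] using hr'
      refine Polynomial.coeff_eq_zero_of_natDegree_lt ?_
      exact lt_of_le_of_lt ((Polynomial.natDegree_mul_C_le _ _).trans
        (Polynomial.natDegree_map_le)) (by omega)
    rw [Polynomial.finsetSum_coeff, Finset.sum_eq_single n (fun r hr h => hterm r h hr)]
    · rw [Polynomial.coeff_mul_C, Polynomial.coeff_map, hscoeff, ← Algebra.smul_def, smul_smul,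
        mul_inv_cancel₀ (by positivity), one_smul]
    · intro h
      rw [Polynomial.coeff_eq_zero_of_natDegree_lt (p := p) (by simp at h; omega)]
      simp

/-- A polynomial `q` with `q(x + 1) - q(x) = p(x)` and `q(0) = 0`. -/
noncomputable def antidifference (p : R[X]) : R[X] := (exists_antidifference p).choose

lemma evalAt_zero_antidifference (p : R[X]) : evalAt 0 (antidifference p) = 0 :=
  (exists_antidifference p).choose_spec.1

lemma evalAt_antidifference (p : R[X]) (x : ℝ) :
    evalAt (x + 1) (antidifference p) = evalAt x (antidifference p) + evalAt x p :=
  (exists_antidifference p).choose_spec.2.1 x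

lemma natDegree_antidifference_le {p : R[X]} {n : ℕ} (h : p.natDegree ≤ n) :
    (antidifference p).natDegree ≤ n + 1 :=
  ((exists_antidifference p).choose_spec.2.2 n h).1

lemma coeff_antidifference {p : R[X]} {n : ℕ} (h : p.natDegree ≤ n) :
    ((n + 1 : ℕ) : ℝ) • (antidifference p).coeff (n + 1) = p.coeff n :=
  ((exists_antidifference p).choose_spec.2.2 n h).2

end Antidifference

/-! ### Composition of k steps: degree, parity and unitarity of its coefficients. -/

section Global

open Polynomial PowerSeries Finset

variable {R : Type*} [Ring R] [Algebra ℝ R]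

/-- The coefficients of `globalSeries`. -/
noncomputable def globalCoeff (F : R[X]⟦X⟧) : ℕ → R[X]
  | 0 => 1
  | n + 1 => antidifference
      (∑ m : Fin (n + 1), PowerSeries.coeff (n + 1 - m) F * globalCoeff F m)

/-- If `F` represents a step of a one-step method, `globalSeries F` represents the composition of
`q` steps; its coefficients are polynomials in `q`. -/
noncomputable def globalSeries (F : R[X]⟦X⟧) : R[X]⟦X⟧ := PowerSeries.mk (globalCoeff F)

variable {F : R[X]⟦X⟧}

lemma globalCoeff_zero : globalCoeff F 0 = 1 := by rw [globalCoeff]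

/-- This is the coefficient of X^(n+1) in G(q + 1) = F(q) G(q): when F has constant coefficient 1,
the term m = n + 1 of the product moves to the left and leaves a difference. -/
lemma globalCoeff_succ (n : ℕ) : globalCoeff F (n + 1) = antidifference
    (∑ m ∈ range (n + 1), PowerSeries.coeff (n + 1 - m) F * globalCoeff F m) := by
  rw [globalCoeff, Finset.sum_range]

lemma evalAt_zero (p : R[X]) : evalAt 0 p = p.coeff 0 := by
  rw [evalAt_eq_sum (Nat.lt_succ_self _), Finset.sum_range_succ']
  simp

lemma coeff_zero_globalCoeff (n : ℕ) : (globalCoeff F (n + 1)).coeff 0 = 0 := by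
  rw [← evalAt_zero, globalCoeff_succ, evalAt_zero_antidifference]

lemma evalSeries_zero_globalSeries :
    evalSeries 0 (globalSeries F) = 1 := by
  ext n
  cases n with
  | zero => rw [coeff_evalSeries]; simp [globalSeries, globalCoeff_zero]
  | succ n =>
    rw [coeff_evalSeries, evalAt_zero]
    simp [globalSeries, coeff_zero_globalCoeff, PowerSeries.coeff_one]

lemma evalSeries_add_one_globalSeries (hF : PowerSeries.coeff 0 F = 1) (x : ℝ) :
    evalSeries (x + 1) (globalSeries F)
      = evalSeries x F
        * evalSeries x (globalSeries F) := by
  rw [← map_mul]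
  ext n
  simp only [coeff_evalSeries, PowerSeries.coeff_mul]
  cases n with
  | zero => simp [globalSeries, globalCoeff_zero, hF]
  | succ n =>
    rw [← Finset.Nat.sum_antidiagonal_swap, Finset.Nat.sum_antidiagonal_eq_sum_range_succ_mk,
      Finset.sum_range_succ]
    simp only [Prod.swap, globalSeries, PowerSeries.coeff_mk, Nat.sub_self, hF, one_mul]
    rw [globalCoeff_succ, evalAt_antidifference, map_add, add_comm]

lemma natDegree_sum_le (hF : IsGraded F) (n : ℕ)
    (h : ∀ m ≤ n, (globalCoeff F m).natDegree ≤ m) :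
    (∑ m ∈ range (n + 1), PowerSeries.coeff (n + 1 - m) F * globalCoeff F m).natDegree ≤ n := by
  refine Polynomial.natDegree_sum_le_of_forall_le _ _ fun m hm => ?_
  simp only [mem_range] at hm
  have h1 := h m (by omega)
  have h2 := hF (n + 1 - m)
  exact Polynomial.natDegree_mul_le.trans (by omega)

lemma natDegree_globalCoeff_le (hF : IsGraded F) (n : ℕ) :
    (globalCoeff F n).natDegree ≤ n := by
  induction n using Nat.strong_induction_on with
  | _ n ih =>
  cases n with
  | zero => simp [globalCoeff_zero]
  | succ n =>
    rw [globalCoeff_succ]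
    exact natDegree_antidifference_le (natDegree_sum_le hF n fun m hm => ih m (by omega))

/-- In top degree the antidifference acts as integration, so the diagonal coefficients obey the
power series recursion of u' = A u, with A given by the `topCoeff` of `F`. -/
lemma coeff_globalCoeff_self (hF : IsGraded F) (n : ℕ) :
    ((n + 1 : ℕ) : ℝ) • (globalCoeff F (n + 1)).coeff (n + 1)
      = ∑ m ∈ range (n + 1), topCoeff F (n - m) * (globalCoeff F m).coeff m := by
  rw [globalCoeff_succ,
    coeff_antidifference (natDegree_sum_le hF n fun m _ => natDegree_globalCoeff_le hF m),
    Polynomial.finsetSum_coeff]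
  refine Finset.sum_congr rfl fun m hm => ?_
  simp only [mem_range] at hm
  have h2 := hF (n + 1 - m)
  have h3 := Polynomial.coeff_mul_add_eq_of_natDegree_le
    (show (PowerSeries.coeff (n + 1 - m) F).natDegree ≤ n - m by omega)
    (natDegree_globalCoeff_le hF m)
  rw [Nat.sub_add_cancel (by omega)] at h3
  rw [h3, topCoeff, Nat.sub_add_comm (by omega)]

lemma exists_coeff_eq {S : Type*} [Semiring S] (p : S[X]) (φ : ℕ → S → S) (hφ : ∀ i, φ i 0 = 0) :
    ∃ p' : S[X], p'.natDegree ≤ p.natDegree ∧ ∀ i, p'.coeff i = φ i (p.coeff i) := by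
  refine ⟨∑ i ∈ range (p.natDegree + 1), Polynomial.monomial i (φ i (p.coeff i)), ?_, fun i => ?_⟩
  · refine Polynomial.natDegree_sum_le_of_forall_le _ _ fun i hi => ?_
    exact (Polynomial.natDegree_monomial_le _).trans (by simp at hi; omega)
  · simp only [Polynomial.finsetSum_coeff, Polynomial.coeff_monomial, Finset.sum_ite_eq', mem_range]
    split_ifs with h
    · rfl
    · rw [Polynomial.coeff_eq_zero_of_natDegree_lt (by omega), hφ]

/-- The substitution q ↦ -(q + 1), X ↦ -X formally reverses a step; `hF` says that the reversed step
is the inverse, so running G backwards from 0 with step -X retraces the forward steps. -/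
lemma scale_evalSeries_neg_globalSeries (hF0 : PowerSeries.coeff 0 F = 1)
    (hF : ∀ q : ℕ, evalSeries (q : ℝ) F
      * scale (-1) (evalSeries (-((q : ℝ) + 1)) F) = 1) (k : ℕ) :
    scale (-1) (evalSeries (-(k : ℝ)) (globalSeries F))
      = evalSeries (k : ℝ) (globalSeries F) := by
  induction k with
  | zero => simp [evalSeries_zero_globalSeries]
  | succ k ih =>
    have h := evalSeries_add_one_globalSeries hF0 (-((k : ℝ) + 1))
    rw [show -((k : ℝ) + 1) + 1 = -k by ring] at h
    rw [h, map_mul] at ih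
    push_cast
    rw [evalSeries_add_one_globalSeries hF0, ← ih, ← mul_assoc, hF, one_mul]

/-- The equality of G(-k) at -X with G(k) at X for all natural k is a polynomial identity: (-1)^n
p(-k) = p(k) for the n-th coefficient p. -/
lemma coeff_globalCoeff_eq_zero (hF0 : PowerSeries.coeff 0 F = 1)
    (hF : ∀ q : ℕ, evalSeries (q : ℝ) F
      * scale (-1) (evalSeries (-((q : ℝ) + 1)) F) = 1)
    {n i : ℕ} (h : Odd (n + i)) : (globalCoeff F n).coeff i = 0 := by
  obtain ⟨p, hpdeg, hp⟩ := exists_coeff_eq (globalCoeff F n)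
    (fun i a => ((-1 : ℝ) ^ (n + i)) • a) fun i => smul_zero _
  have heq : p - globalCoeff F n = 0 := by
    refine eq_zero_of_forall_evalAt_natCast fun k => ?_
    have h1 := congrArg (PowerSeries.coeff n) (scale_evalSeries_neg_globalSeries hF0 hF k)
    simp only [coeff_scale, coeff_evalSeries, globalSeries, PowerSeries.coeff_mk] at h1
    rw [map_sub, sub_eq_zero, ← h1, evalAt_eq_sum (Nat.lt_succ_of_le hpdeg),
      evalAt_eq_sum (Nat.lt_succ_self _), smul_sum]
    refine Finset.sum_congr rfl fun j _ => ?_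
    rw [hp, smul_smul, smul_smul, neg_pow (k : ℝ), pow_add]
    congr 1
    ring
  have h2 := hp i
  rw [sub_eq_zero.1 heq, h.neg_one_pow, neg_one_smul] at h2
  have h3 : (2 : ℝ) • (globalCoeff F n).coeff i = 0 := by
    rw [two_smul]
    nth_rewrite 1 [h2]
    exact neg_add_cancel _
  have h4 := congrArg (fun a => (2 : ℝ)⁻¹ • a) h3
  simpa [smul_smul] using h4

variable [StarRing R] [StarModule ℝ R]

/-- The coefficientwise adjoint of a power series. -/
noncomputable def starSeries (P : R⟦X⟧) : R⟦X⟧ :=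
  PowerSeries.mk fun n => star (PowerSeries.coeff n P)

/-- Unitarity for every natural k is an identity of polynomials in k. Its coefficient of k^n is
unitarity of the limiting flow. In its coefficient of k only the two terms containing the constant
coefficient survive, since all other coefficients vanish at k = 0. -/
lemma star_globalCoeff (hgr : IsGraded F)
    (hF : ∀ k : ℕ, starSeries (evalSeries (k : ℝ) (globalSeries F))
      * evalSeries (k : ℝ) (globalSeries F) = 1) {n : ℕ} (hn : n ≠ 0) :
    (∑ x ∈ antidiagonal n, star ((globalCoeff F x.1).coeff x.1) * (globalCoeff F x.2).coeff x.2
      = 0) ∧ star ((globalCoeff F n).coeff 1) + (globalCoeff F n).coeff 1 = 0 := by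
  have hex := fun m => exists_coeff_eq (globalCoeff F m) (fun _ a => star a) fun _ => star_zero R
  choose S hSdeg hS using hex
  have hT : ∑ x ∈ antidiagonal n, S x.1 * globalCoeff F x.2 = 0 := by
    refine eq_zero_of_forall_evalAt_natCast fun k => ?_
    have h1 := congrArg (PowerSeries.coeff n) (hF k)
    rw [PowerSeries.coeff_mul, PowerSeries.coeff_one, if_neg hn] at h1
    rw [map_sum, ← h1]
    refine Finset.sum_congr rfl fun x _ => ?_
    simp only [starSeries, globalSeries, coeff_evalSeries, PowerSeries.coeff_mk, map_mul]
    congr 1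
    rw [evalAt_eq_sum (Nat.lt_succ_of_le (hSdeg _)), evalAt_eq_sum (Nat.lt_succ_self _), star_sum]
    exact Finset.sum_congr rfl fun j _ => by simp [hS]
  constructor
  · have h := congrArg (fun p => Polynomial.coeff p n) hT
    simp only [Polynomial.finsetSum_coeff, Polynomial.coeff_zero] at h
    rw [← h]
    refine Finset.sum_congr rfl fun x hx => ?_
    have hd := natDegree_globalCoeff_le hgr
    conv_rhs => rw [← HasAntidiagonal.mem_antidiagonal.1 hx]
    rw [Polynomial.coeff_mul_add_eq_of_natDegree_le ((hSdeg _).trans (hd _)) (hd _), hS]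
  · have h := congrArg (fun p => Polynomial.coeff p 1) hT
    simp only [Polynomial.finsetSum_coeff, Polynomial.coeff_zero] at h
    obtain ⟨n, rfl⟩ := Nat.exists_eq_succ_of_ne_zero hn
    have hS0 : S 0 = 1 := by
      ext i
      rw [hS, globalCoeff_zero, Polynomial.coeff_one]
      split_ifs <;> simp
    rw [Finset.Nat.sum_antidiagonal_succ, hS0, one_mul] at h
    cases n with
    | zero => simpa [globalCoeff_zero, hS, add_comm] using h
    | succ n =>
      rw [Finset.Nat.sum_antidiagonal_succ', Finset.sum_eq_zero] at h
      · simpa [globalCoeff_zero, hS, add_comm] using h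
      · intro x _
        simp [Polynomial.mul_coeff_one, hS, coeff_zero_globalCoeff]

end Global

/-! ### Germs at a point of the interval, Taylor series and linear differential equations. -/

section Germ

open Asymptotics Filter Set

/-- The filter of the increments `h → 0` with `s + h ∈ I`. -/
def germ (I : Set ℝ) (s : ℝ) : Filter ℝ := 𝓝[(s + ·) ⁻¹' I] 0

lemma germ_le (I : Set ℝ) (s : ℝ) : germ I s ≤ 𝓝 0 := nhdsWithin_le_nhds

lemma tendsto_add_germ (I : Set ℝ) (s : ℝ) : Tendsto (s + ·) (germ I s) (𝓝[I] s) := by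
  refine tendsto_nhdsWithin_iff.2 ⟨?_, self_mem_nhdsWithin⟩
  have : Tendsto (s + ·) (𝓝 0) (𝓝 (s + 0)) := (continuous_const_add s).tendsto 0
  rw [add_zero] at this
  exact this.mono_left (germ_le I s)

lemma tendsto_sub_germ (I : Set ℝ) (s : ℝ) : Tendsto (· - s) (𝓝[I] s) (germ I s) := by
  refine tendsto_nhdsWithin_iff.2 ⟨?_, ?_⟩
  · have : Tendsto (· - s) (𝓝 s) (𝓝 (s - s)) := (continuous_sub_right s).tendsto s
    rw [sub_self] at this
    exact this.mono_left nhdsWithin_le_nhds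
  · filter_upwards [self_mem_nhdsWithin] with t ht
    simpa using ht

variable {α β s : ℝ}

/-- The sign of `c` matters at an end point of the interval, where only increments of one sign are
admissible. -/
lemma tendsto_mul_germ (hs : s ∈ Icc α β) {c : ℝ} (hc : 0 ≤ c) :
    Tendsto (c * ·) (germ (Icc α β) s) (germ (Icc α β) s) := by
  have h0 : Tendsto (c * ·) (germ (Icc α β) s) (𝓝 0) := by
    have : Tendsto (c * ·) (𝓝 0) (𝓝 (c * 0)) := (continuous_const_mul c).tendsto 0
    rw [mul_zero] at this
    exact this.mono_left (germ_le _ _)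
  refine tendsto_nhdsWithin_iff.2 ⟨h0, ?_⟩
  have hmem : ∀ᶠ h in germ (Icc α β) s, s + h ∈ Icc α β := self_mem_nhdsWithin
  have h1 : ∀ᶠ h in germ (Icc α β) s, α ≤ s + c * h := by
    rcases hs.1.eq_or_lt with h | h
    · filter_upwards [hmem] with x hx
      have : 0 ≤ x := by linarith [hx.1]
      nlinarith [mul_nonneg hc this]
    · filter_upwards [h0.eventually (lt_mem_nhds (show α - s < 0 by linarith))] with x hx
      linarith
  have h2 : ∀ᶠ h in germ (Icc α β) s, s + c * h ≤ β := by
    rcases hs.2.eq_or_lt with h | h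
    · filter_upwards [hmem] with x hx
      have : x ≤ 0 := by linarith [hx.2]
      nlinarith [mul_nonneg hc (neg_nonneg.2 this)]
    · filter_upwards [h0.eventually (gt_mem_nhds (show 0 < β - s by linarith))] with x hx
      linarith
  filter_upwards [h1, h2] with x hx1 hx2 using ⟨hx1, hx2⟩

lemma eventually_germ_mem (hs : s ∈ Icc α β) {c : ℝ} (hc : 0 ≤ c) :
    ∀ᶠ h in germ (Icc α β) s, s + c * h ∈ Icc α β :=
  (tendsto_mul_germ hs hc).eventually self_mem_nhdsWithin

lemma germ_neBot (hαβ : α < β) (hs : s ∈ Icc α β) :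
    (germ (Icc α β) s ⊓ 𝓟 {0}ᶜ).NeBot := by
  rw [germ, nhdsWithin, inf_assoc, inf_principal, ← nhdsWithin]
  rcases hs.2.eq_or_lt with h | h
  · have hle : 𝓝[<] (0 : ℝ) ≤ 𝓝[((s + ·) ⁻¹' Icc α β) ∩ {0}ᶜ] 0 := by
      rw [← nhdsWithin_Ioo_eq_nhdsLT (show α - s < 0 by linarith)]
      refine nhdsWithin_mono _ fun x hx => ⟨⟨?_, ?_⟩, hx.2.ne⟩ <;> linarith [hx.1, hx.2]
    exact NeBot.mono inferInstance hle
  · have hle : 𝓝[>] (0 : ℝ) ≤ 𝓝[((s + ·) ⁻¹' Icc α β) ∩ {0}ᶜ] 0 := by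
      rw [← nhdsWithin_Ioo_eq_nhdsGT (show 0 < β - s by linarith)]
      refine nhdsWithin_mono _ fun x hx => ⟨⟨?_, ?_⟩, hx.1.ne'⟩ <;>
        linarith [hx.1, hx.2, hs.1]
    exact NeBot.mono inferInstance hle

variable {𝔸 : Type*} [NormedRing 𝔸] [NormedAlgebra ℝ 𝔸]

/-- The Taylor series at `s` of a function on `I`. -/
noncomputable def taylorSeries (G : ℝ → 𝔸) (I : Set ℝ) (s : ℝ) : PowerSeries 𝔸 :=
  PowerSeries.mk fun r => taylorCoeffWithin G r I s

lemma hasExpansion_taylorSeries {G : ℝ → 𝔸} (hG : ContDiffOn ℝ ∞ G (Icc α β))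
    (hs : s ∈ Icc α β) :
    HasExpansion (germ (Icc α β) s) (fun h => G (s + h)) (taylorSeries G (Icc α β) s) := by
  intro n
  cases n with
  | zero =>
    have h1 := ((hG.continuousOn s hs).tendsto.comp (tendsto_add_germ (Icc α β) s)).isBigO_one ℝ
    simpa using h1
  | succ n =>
    have h1 := ((taylor_isLittleO (n := n + 1) (convex_Icc α β) hs
      (hG.of_le (by exact_mod_cast le_top))).isBigO).comp_tendsto (tendsto_add_germ (Icc α β) s)
    have h2 : (fun h : ℝ => h ^ (n + 1) • taylorCoeffWithin G (n + 1) (Icc α β) s)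
        =O[germ (Icc α β) s] fun h => h ^ (n + 1) := pow_smul_isBigO _ _
    refine (h1.add (h2.congr_right fun x => ?_)).congr (fun x => ?_) fun x => ?_
    · simp
    · simp only [Function.comp_apply, taylor_within_apply, taylorSeries, PowerSeries.coeff_mk,
        taylorCoeffWithin, add_sub_cancel_left, smul_smul]
      rw [Finset.sum_range_succ _ (n + 1)]
      simp only [mul_comm]
      abel
    · simp

lemma isBigO_pow_succ_of_hasDerivWithinAt {J : Set ℝ} (hJ : Convex ℝ J) (h0 : 0 ∈ J)
    {r r' : ℝ → 𝔸} (hr0 : r 0 = 0) (hr : ∀ h ∈ J, HasDerivWithinAt r (r' h) J h) {n : ℕ}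
    (hO : r' =O[𝓝[J] 0] fun h => h ^ n) : r =O[𝓝[J] 0] fun h => h ^ (n + 1) := by
  obtain ⟨C, hC⟩ := hO.bound
  obtain ⟨ε, hε, hball⟩ := Metric.mem_nhdsWithin_iff.1 hC
  refine IsBigO.of_bound |C| ?_
  filter_upwards [inter_mem (nhdsWithin_le_nhds (Metric.ball_mem_nhds 0 hε)) self_mem_nhdsWithin]
    with h hh
  have hhε : |h| < ε := by simpa using hh.1
  have hconv : Convex ℝ (J ∩ Icc (-|h|) |h|) := hJ.inter (convex_Icc _ _)
  have key := hconv.norm_image_sub_le_of_norm_hasDerivWithin_le (C := |C| * |h| ^ n)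
    (f := r) (f' := r') (x := 0) (y := h)
    (fun x hx => (hr x hx.1).mono inter_subset_left) (fun x hx => ?_)
    ⟨h0, by simp, by simp⟩ ⟨hh.2, neg_abs_le h, le_abs_self h⟩
  · rw [hr0, sub_zero, sub_zero, Real.norm_eq_abs] at key
    rw [norm_pow, Real.norm_eq_abs, pow_succ, ← mul_assoc]
    exact key
  · have hxh : |x| ≤ |h| := abs_le.2 hx.2
    have h1 : ‖r' x‖ ≤ C * ‖x ^ n‖ :=
      hball ⟨by simpa using lt_of_le_of_lt hxh hhε, hx.1⟩
    rw [norm_pow, Real.norm_eq_abs] at h1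
    calc ‖r' x‖ ≤ C * |x| ^ n := h1
      _ ≤ |C| * |x| ^ n := by gcongr; exact le_abs_self C
      _ ≤ |C| * |h| ^ n := by gcongr

lemma hasExpansion_evalAt {l : Filter ℝ} (hl : l ≤ 𝓝 0) (p : Polynomial 𝔸) :
    HasExpansion l (fun h => evalAt h p) (p : PowerSeries 𝔸) := by
  intro n
  refine (evalAt_isBigO (p := p - (p : PowerSeries 𝔸).trunc n) (n := n) hl fun i hi => ?_).congr_left
    fun h => by rw [map_sub, evalAt_trunc]
  simp [PowerSeries.coeff_trunc, hi]

/-- The expansion of the solution of a linear differential equation `u' = A u`, `u(s) = 1`. -/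
lemma hasExpansion_of_hasDerivWithinAt {A u : ℝ → 𝔸} {a : PowerSeries 𝔸} {c : ℕ → 𝔸}
    (hs : s ∈ Icc α β) (hA : HasExpansion (germ (Icc α β) s) (fun h => A (s + h)) a)
    (hu0 : u s = 1)
    (hu : ∀ t ∈ Icc α β, HasDerivWithinAt u (A t * u t) (Icc α β) t) (hc0 : c 0 = 1)
    (hc : ∀ n : ℕ, ((n + 1 : ℕ) : ℝ) • c (n + 1)
      = ∑ m ∈ Finset.range (n + 1), PowerSeries.coeff (n - m) a * c m) :
    HasExpansion (germ (Icc α β) s) (fun h => u (s + h)) (PowerSeries.mk c) := by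
  have hl := germ_le (Icc α β) s
  have hderiv : ∀ h ∈ (s + ·) ⁻¹' Icc α β, HasDerivWithinAt (fun x => u (s + x))
      (A (s + h) * u (s + h)) ((s + ·) ⁻¹' Icc α β) h := fun h hh => by
    have h1 := (hu (s + h) hh).scomp (h := fun x => s + x) (h' := (1 : ℝ)) h
      ((hasDerivAt_id h).const_add s).hasDerivWithinAt (mapsTo_preimage _ _)
    rw [one_smul] at h1
    exact h1
  intro n
  induction n with
  | zero =>
    have h1 := ((hu s hs).continuousWithinAt.tendsto.comp
      (tendsto_add_germ (Icc α β) s)).isBigO_one ℝ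
    simpa using h1
  | succ n ih =>
    set p : Polynomial 𝔸 := (PowerSeries.mk c).trunc n with hp
    have hpexp := hA.mul hl (hasExpansion_evalAt hl p)
    have e1 := hA.isBigO_one.mul ih
    have e2 := hpexp n
    simp only [one_mul] at e1
    -- Bootstrap: with p the truncation of degree below n, the remainder one order higher has
    -- derivative A (u - p) + (A p - its expansion to order n), which is O(h^n); the mean value
    -- inequality gains one power.
    refine isBigO_pow_succ_of_hasDerivWithinAt (J := (s + ·) ⁻¹' Icc α β)
      (r' := fun h => A (s + h) * u (s + h)
        - ∑ i ∈ Finset.range n, (((i + 1 : ℕ) : ℝ) * h ^ i) • c (i + 1)) ?_ ?_ ?_ ?_ ?_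
    · exact (convex_Icc α β).translate_preimage_right s
    · simpa using hs
    · rw [Finset.sum_range_succ']
      simp [hu0, hc0]
    · intro h hh
      refine (hderiv h hh).sub ?_
      have h2 : ∀ i ∈ Finset.range n, HasDerivAt (fun x : ℝ => x ^ (i + 1) • c (i + 1))
          ((((i + 1 : ℕ) : ℝ) * h ^ i) • c (i + 1)) h := fun i _ => by
        simpa using (hasDerivAt_pow (i + 1) h).smul_const (c (i + 1))
      have h3 := (HasDerivAt.fun_sum h2).add_const (c 0)
      refine HasDerivAt.hasDerivWithinAt ?_
      simp only [Finset.sum_range_succ', PowerSeries.coeff_mk, pow_zero, one_smul]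
      exact h3
    · refine (e1.add e2).congr_left fun h => ?_
      have h4 : ∑ i ∈ Finset.range n, h ^ i • PowerSeries.coeff i (a * (p : PowerSeries 𝔸))
          = ∑ i ∈ Finset.range n, (((i + 1 : ℕ) : ℝ) * h ^ i) • c (i + 1) := by
        refine Finset.sum_congr rfl fun i hi => ?_
        simp only [Finset.mem_range] at hi
        rw [mul_comm, mul_smul, hc, PowerSeries.coeff_mul, ← Finset.Nat.sum_antidiagonal_swap,
          Finset.Nat.sum_antidiagonal_eq_sum_range_succ_mk]
        congr 1
        refine Finset.sum_congr rfl fun j hj => ?_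
        simp only [Finset.mem_range] at hj
        simp [hp, PowerSeries.coeff_trunc, show j < n by omega]
      rw [h4, ← evalAt_trunc, ← hp]
      noncomm_ring

end Germ

/-! ### Coefficients of the multiproduct formula. -/

section MultiSeries

open PowerSeries Finset

variable {R : Type*} [Ring R] [Algebra ℝ R] {M : ℕ}

/-- The power series that represents the multiproduct formula with base series `F`. -/
noncomputable def multiSeries (a : Fin M → ℝ) (k : Fin M → ℕ) (F : (Polynomial R)⟦X⟧) : R⟦X⟧ :=
  ∑ j, a j • scale ((k j : ℝ)⁻¹) (evalSeries (k j : ℝ) (globalSeries F))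

variable {a : Fin M → ℝ} {k : Fin M → ℕ} {F : (Polynomial R)⟦X⟧}

lemma coeff_multiSeries (hF : IsGraded F) (n : ℕ) : coeff n (multiSeries a k F)
    = ∑ i ∈ range (n + 1), (∑ j, a j * ((k j : ℝ) ^ i * ((k j : ℝ)⁻¹) ^ n)) •
      (globalCoeff F n).coeff i := by
  simp only [multiSeries, map_sum, PowerSeries.coeff_smul, coeff_scale, coeff_evalSeries,
    globalSeries, coeff_mk]
  simp only [evalAt_eq_sum (Nat.lt_succ_of_le (natDegree_globalCoeff_le hF n)), Finset.smul_sum,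
    Finset.sum_smul, smul_smul]
  rw [Finset.sum_comm]
  refine Finset.sum_congr rfl fun i _ => Finset.sum_congr rfl fun j _ => ?_
  congr 1
  ring

lemma sum_weight (hk : ∀ j, 1 ≤ k j) (i l : ℕ) :
    ∑ j, a j * ((k j : ℝ) ^ i * ((k j : ℝ)⁻¹) ^ (i + 2 * l))
      = ∑ j, a j * ((k j : ℝ) ^ (2 * l))⁻¹ := by
  refine Finset.sum_congr rfl fun j _ => ?_
  have : (k j : ℝ) ≠ 0 := by
    have := hk j
    positivity
  congr 1
  rw [pow_add, ← mul_assoc, ← mul_pow, mul_inv_cancel₀ this, one_pow, one_mul, inv_pow]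

variable (hM : 1 ≤ M) (hk : ∀ j, 1 ≤ k j) (hak : VandermondeSystem a k) (hgr : IsGraded F)
  (hpar : ∀ n i, Odd (n + i) → (globalCoeff F n).coeff i = 0)
include hM hk hak hgr hpar

lemma coeff_multiSeries_of_le {n : ℕ} (hn : n ≤ 2 * M) :
    coeff n (multiSeries a k F) = (globalCoeff F n).coeff n := by
  rw [coeff_multiSeries hgr, Finset.sum_eq_single_of_mem n (by simp)]
  · have := sum_weight (a := a) hk n 0
    rw [mul_zero, add_zero] at this
    rw [this]
    have h0 := hak 0 (by omega)
    simp only [mul_zero, if_true] at h0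
    rw [h0, one_smul]
  · intro i hi hin
    simp only [mem_range] at hi
    rcases Nat.even_or_odd (n + i) with h | h
    · obtain ⟨l, rfl⟩ : ∃ l, n = i + 2 * l := by
        obtain ⟨m, hm⟩ := h
        exact ⟨m - i, by omega⟩
      rw [sum_weight hk]
      by_cases hl : l < M
      · rw [hak l hl, if_neg (by omega), zero_smul]
      -- The Vandermonde system is silent for l ≥ M, but n ≤ 2M then forces i = 0, where the
      -- coefficient vanishes anyway.
      · obtain rfl : i = 0 := by omega
        obtain ⟨m, hm⟩ : ∃ m, 0 + 2 * l = m + 1 := ⟨2 * l - 1, by omega⟩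
        rw [hm, coeff_zero_globalCoeff, smul_zero]
    · rw [hpar _ _ h, smul_zero]

/-- At this order i = 1 corresponds to l = M, the first power of 1/k beyond the Vandermonde system.
-/
lemma coeff_multiSeries_two_mul_add_one : ∃ γ : ℝ, coeff (2 * M + 1) (multiSeries a k F)
    = (globalCoeff F (2 * M + 1)).coeff (2 * M + 1)
      + γ • (globalCoeff F (2 * M + 1)).coeff 1 := by
  refine ⟨∑ j, a j * ((k j : ℝ) ^ (2 * M))⁻¹, ?_⟩
  have hsum : ∀ i ∈ range (2 * M + 1 + 1), i ∉ ({2 * M + 1, 1} : Finset ℕ) →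
      (∑ j, a j * ((k j : ℝ) ^ i * ((k j : ℝ)⁻¹) ^ (2 * M + 1))) •
        (globalCoeff F (2 * M + 1)).coeff i = 0 := by
    intro i hi hi'
    simp only [mem_range, mem_insert, mem_singleton, not_or] at hi hi'
    rcases Nat.even_or_odd (2 * M + 1 + i) with h | h
    · obtain ⟨l, hl⟩ : ∃ l, 2 * M + 1 = i + 2 * l := by
        obtain ⟨m, hm⟩ := h
        exact ⟨m - i, by omega⟩
      rw [hl, sum_weight hk, hak l (by omega), if_neg (by omega), zero_smul]
    · rw [hpar _ _ h, smul_zero]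
  have hsub : ({2 * M + 1, 1} : Finset ℕ) ⊆ range (2 * M + 1 + 1) := by
    intro i hi
    simp only [mem_insert, mem_singleton] at hi
    simp only [mem_range]
    omega
  rw [coeff_multiSeries hgr, ← Finset.sum_subset hsub hsum, Finset.sum_pair (by omega)]
  congr 2
  · have := sum_weight (a := a) hk (2 * M + 1) 0
    rw [mul_zero, add_zero] at this
    rw [this]
    have h0 := hak 0 (by omega)
    simp only [mul_zero, if_true] at h0
    rw [h0, one_smul]
  · rw [← sum_weight hk 1 M, add_comm 1]

lemma coeff_star_multiSeries_mul [StarRing R] [StarModule ℝ R]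
    (hun : ∀ n ≠ 0, (∑ x ∈ antidiagonal n,
        star ((globalCoeff F x.1).coeff x.1) * (globalCoeff F x.2).coeff x.2 = 0) ∧
      star ((globalCoeff F n).coeff 1) + (globalCoeff F n).coeff 1 = 0) {n : ℕ}
    (hn : n < 2 * M + 2) :
    coeff n (starSeries (multiSeries a k F) * multiSeries a k F - 1) = 0 := by
  have hle := fun n (hn : n ≤ 2 * M) => coeff_multiSeries_of_le hM hk hak hgr hpar hn
  have h0 := hle 0 (by omega)
  rw [globalCoeff_zero, Polynomial.coeff_one_zero] at h0
  rw [map_sub, PowerSeries.coeff_mul, PowerSeries.coeff_one]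
  simp only [starSeries, PowerSeries.coeff_mk]
  rcases Nat.lt_succ_iff_lt_or_eq.1 hn with hn' | rfl
  · have : ∀ x ∈ antidiagonal n,
        star (coeff x.1 (multiSeries a k F)) * coeff x.2 (multiSeries a k F)
          = star ((globalCoeff F x.1).coeff x.1) * (globalCoeff F x.2).coeff x.2 := by
      intro x hx
      have := HasAntidiagonal.mem_antidiagonal.1 hx
      rw [hle _ (by omega), hle _ (by omega)]
    rw [Finset.sum_congr rfl this]
    split_ifs with hn0
    · subst hn0
      simp [globalCoeff_zero]
    · rw [(hun n hn0).1, sub_zero]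
  · obtain ⟨γ, hγ⟩ := coeff_multiSeries_two_mul_add_one hM hk hak hgr hpar
    obtain ⟨h1, h2⟩ := hun (2 * M + 1) (by omega)
    rw [if_neg (by omega), sub_zero]
    obtain ⟨m, hm⟩ : ∃ m, 2 * M = m + 1 := ⟨2 * M - 1, by omega⟩
    -- Away from the two end terms all indices are at most 2M, so γ enters only through the end
    -- terms, where its contributions cancel by skew-adjointness.
    have h3 : ∀ x ∈ antidiagonal m, star (coeff (x.1 + 1) (multiSeries a k F))
          * coeff (x.2 + 1) (multiSeries a k F)
        = star ((globalCoeff F (x.1 + 1)).coeff (x.1 + 1))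
          * (globalCoeff F (x.2 + 1)).coeff (x.2 + 1) := by
      intro x hx
      have := HasAntidiagonal.mem_antidiagonal.1 hx
      rw [hle _ (by omega), hle _ (by omega)]
    rw [hm] at h1 h2 hγ ⊢
    rw [Finset.Nat.sum_antidiagonal_succ, Finset.Nat.sum_antidiagonal_succ'] at h1 ⊢
    simp only [globalCoeff_zero, Polynomial.coeff_one_zero, star_one, one_mul,
      mul_one] at h1 ⊢
    rw [Finset.sum_congr rfl h3, h0, hγ, star_one, one_mul, mul_one, star_add, star_smul,
      star_trivial γ]
    have h4 : γ • star ((globalCoeff F (m + 1 + 1)).coeff 1)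
        + γ • (globalCoeff F (m + 1 + 1)).coeff 1 = 0 := by
      rw [← smul_add, h2, smul_zero]
    rw [← add_zero (0 : R)]
    nth_rewrite 1 [← h1]
    rw [← h4]
    abel

end MultiSeries

/-! ### Expansions of product formulas and of their compositions. -/

section Formula

open Asymptotics Filter Set

variable {α β s : ℝ} {𝔸 : Type*} [NormedRing 𝔸] [NormedAlgebra ℝ 𝔸]

/-- The Taylor series at `s` of the generators of a product formula. -/
noncomputable def taylorList (L : List ((ℝ → 𝔸) × ℝ)) (I : Set ℝ) (s : ℝ) :
    List (PowerSeries 𝔸 × ℝ) := L.map fun p => (taylorSeries p.1 I s, p.2)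

/-- The product of exponentials with generators and evaluation points given by the list `L`. -/
noncomputable def productStep (L : List ((ℝ → 𝔸) × ℝ)) (t s : ℝ) : 𝔸 :=
  (L.map fun p => NormedSpace.exp ((t - s) • p.1 (s + p.2 * (t - s)))).prod

/-- The composition of `k` steps of length `δ` starting at `s`. -/
noncomputable def stepProd {S : Type*} [Monoid S] (V : ℝ → ℝ → S) (s : ℝ) (k : ℕ) (δ : ℝ) : S :=
  ((List.range k).map fun q : ℕ => V (s + ((q : ℝ) + 1) * δ) (s + (q : ℝ) * δ)).reverse.prod

lemma stepProd_succ {S : Type*} [Monoid S] (V : ℝ → ℝ → S) (s : ℝ) (k : ℕ) (δ : ℝ) :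
    stepProd V s (k + 1) δ = V (s + ((k : ℝ) + 1) * δ) (s + (k : ℝ) * δ) * stepProd V s k δ := by
  simp [stepProd, List.range_succ]

variable [CompleteSpace 𝔸] {L : List ((ℝ → 𝔸) × ℝ)}
  (hL : ∀ p ∈ L, ContDiffOn ℝ ∞ p.1 (Icc α β) ∧ p.2 ∈ Icc (0 : ℝ) 1) (hs : s ∈ Icc α β)
include hL hs

lemma hasExpansion_productStep {q : ℝ} (hq : 0 ≤ q) :
    HasExpansion (germ (Icc α β) s) (fun δ => productStep L (s + (q + 1) * δ) (s + q * δ))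
      (evalSeries q (baseSeries (taylorList L (Icc α β) s))) := by
  have hl := germ_le (Icc α β) s
  rw [evalSeries_baseSeries, taylorList, List.map_map]
  refine (HasExpansion.list_prod hl L fun p hp => HasExpansion.exp hl
    ((hasExpansion_taylorSeries (hL p hp).1 hs).comp_mul_left
      (tendsto_mul_germ hs (add_nonneg hq (hL p hp).2.1)))).congr
    (Eventually.of_forall fun δ => ?_)
  simp only [productStep]
  congr 1
  refine List.map_congr_left fun p _ => ?_
  rw [show s + (q + 1) * δ - (s + q * δ) = δ by ring,
    show s + q * δ + p.2 * δ = s + (q + p.2) * δ by ring]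

/-- Replacing δ by -δ could leave the interval at an end point, so the reversal is done on the
series. The actual generators are evaluated at `s + (q + 1 - θ) δ`, with q + 1 - θ ≥ 0. -/
lemma hasExpansion_productStep_rev {q : ℝ} (hq : 0 ≤ q) :
    HasExpansion (germ (Icc α β) s) (fun δ => productStep L (s + q * δ) (s + (q + 1) * δ))
      (scale (-1) (evalSeries (-(q + 1)) (baseSeries (taylorList L (Icc α β) s)))) := by
  have hl := germ_le (Icc α β) s
  have hser : scale (-1) (evalSeries (-(q + 1)) (baseSeries (taylorList L (Icc α β) s)))
      = (L.map fun p => expOf (PowerSeries.X *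
        (- scale (q + 1 - p.2) (taylorSeries p.1 (Icc α β) s)))).prod := by
    rw [evalSeries_baseSeries, taylorList, List.map_map, map_list_prod, List.map_map]
    congr 1
    refine List.map_congr_left fun p _ => ?_
    simp only [Function.comp_apply]
    rw [scale_expOf, map_mul, scale_X, scale_scale,
      show -1 * (-(q + 1) + p.2) = q + 1 - p.2 by ring, neg_one_smul, neg_mul, mul_neg]
  rw [hser]
  refine (HasExpansion.list_prod hl L fun p hp => HasExpansion.exp hl
    ((hasExpansion_taylorSeries (hL p hp).1 hs).comp_mul_left (c := q + 1 - p.2)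
      (tendsto_mul_germ hs (by linarith [(hL p hp).2.2]))).neg).congr
    (Eventually.of_forall fun δ => ?_)
  simp only [productStep]
  congr 1
  refine List.map_congr_left fun p _ => ?_
  rw [show s + q * δ - (s + (q + 1) * δ) = -δ by ring,
    show s + (q + 1) * δ + p.2 * -δ = s + (q + 1 - p.2) * δ by ring, smul_neg, neg_smul]

variable {V : ℝ → ℝ → 𝔸} (hV : ∀ t ∈ Icc α β, ∀ s ∈ Icc α β, V t s = productStep L t s)
include hV

lemma hasExpansion_stepProd (k : ℕ) :
    HasExpansion (germ (Icc α β) s) (stepProd V s k)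
      (evalSeries (k : ℝ) (globalSeries (baseSeries (taylorList L (Icc α β) s)))) := by
  induction k with
  | zero =>
    rw [Nat.cast_zero, evalSeries_zero_globalSeries]
    exact HasExpansion.one.congr (Eventually.of_forall fun δ => by simp [stepProd])
  | succ k ih =>
    push_cast
    rw [evalSeries_add_one_globalSeries (coeff_zero_baseSeries _)]
    have hk : (0 : ℝ) ≤ k := Nat.cast_nonneg k
    refine ((hasExpansion_productStep hL hs hk).mul (germ_le _ _) ih).congr ?_
    filter_upwards [eventually_germ_mem hs hk, eventually_germ_mem hs (by positivity : 0 ≤ (k : ℝ) + 1)]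
      with δ h1 h2
    rw [stepProd_succ, hV _ h2 _ h1]

variable (hαβ : α < β) (hinv : ∀ t ∈ Icc α β, ∀ s ∈ Icc α β, V s t * V t s = 1)
include hαβ hinv

lemma evalSeries_mul_scale_evalSeries (q : ℕ) :
    evalSeries (q : ℝ) (baseSeries (taylorList L (Icc α β) s))
      * scale (-1) (evalSeries (-((q : ℝ) + 1)) (baseSeries (taylorList L (Icc α β) s))) = 1 := by
  have := germ_neBot hαβ hs
  have hq : (0 : ℝ) ≤ q := Nat.cast_nonneg q
  refine HasExpansion.unique (germ_le _ _) (((hasExpansion_productStep hL hs hq).mul (germ_le _ _)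
    (hasExpansion_productStep_rev hL hs hq)).congr ?_) HasExpansion.one
  filter_upwards [eventually_germ_mem hs hq, eventually_germ_mem hs (by positivity : 0 ≤ (q : ℝ) + 1)]
    with δ h1 h2
  rw [← hV _ h1 _ h2, ← hV _ h2 _ h1, hinv _ h1 _ h2]

variable [StarRing 𝔸] [NormedStarGroup 𝔸] [StarModule ℝ 𝔸]
  (hstar : ∀ t ∈ Icc α β, ∀ s ∈ Icc α β, star (V t s) = V s t)
include hstar

lemma starSeries_evalSeries_mul (k : ℕ) :
    starSeries (evalSeries (k : ℝ) (globalSeries (baseSeries (taylorList L (Icc α β) s))))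
      * evalSeries (k : ℝ) (globalSeries (baseSeries (taylorList L (Icc α β) s))) = 1 := by
  have := germ_neBot hαβ hs
  have h := hasExpansion_stepProd hL hs hV k
  refine HasExpansion.unique (germ_le _ _) ((h.star.mul (germ_le _ _) h).congr ?_)
    HasExpansion.one
  clear h
  induction k with
  | zero => exact Eventually.of_forall fun δ => by simp [stepProd]
  | succ k ih =>
    filter_upwards [ih, eventually_germ_mem hs (Nat.cast_nonneg (α := ℝ) k),
      eventually_germ_mem hs (by positivity : 0 ≤ (k : ℝ) + 1)] with δ h h1 h2
    rw [stepProd_succ, star_mul, mul_assoc, ← mul_assoc (star (V _ _)), hstar _ h2 _ h1,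
      hinv _ h2 _ h1, one_mul, h]

end Formula

/-! ### Consistency and the order of the multiproduct formula. -/

section Order

open Asymptotics Filter Set

variable {α β s : ℝ} {𝔸 : Type*} [NormedRing 𝔸] [NormedAlgebra ℝ 𝔸] {A : ℝ → 𝔸}
  (hA : ContDiffOn ℝ ∞ A (Icc α β)) (hs : s ∈ Icc α β)

/-- The series of the coefficients `globalCoeff F n` in top degree `n`, which represents the limit
of infinitely many steps. -/
noncomputable def flowSeries (F : PowerSeries (Polynomial 𝔸)) : PowerSeries 𝔸 :=
  PowerSeries.mk fun n => (globalCoeff F n).coeff n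

include hA hs in
lemma hasExpansion_flowSeries {u : ℝ → 𝔸} (hu0 : u s = 1)
    (hu : ∀ t ∈ Icc α β, HasDerivWithinAt u (A t * u t) (Icc α β) t)
    {F : PowerSeries (Polynomial 𝔸)} (hF : IsGraded F)
    (htop : ∀ n, topCoeff F n = PowerSeries.coeff n (taylorSeries A (Icc α β) s)) :
    HasExpansion (germ (Icc α β) s) (fun h => u (s + h)) (flowSeries F) :=
  hasExpansion_of_hasDerivWithinAt hs (hasExpansion_taylorSeries hA hs) hu0 hu
    (by simp [globalCoeff_zero])
    fun n => by simp only [coeff_globalCoeff_self hF, htop]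

lemma coeff_zero_taylorSeries (G : ℝ → 𝔸) (I : Set ℝ) (s : ℝ) :
    PowerSeries.coeff 0 (taylorSeries G I s) = G s := by
  simp [taylorSeries, taylorCoeffWithin]

lemma topCoeff_baseSeries_taylorList (L : List ((ℝ → 𝔸) × ℝ)) (I : Set ℝ) (s : ℝ) (n : ℕ) :
    topCoeff (baseSeries (taylorList L I s)) n
      = (L.map fun p => PowerSeries.coeff n (taylorSeries p.1 I s)).sum := by
  rw [topCoeff_baseSeries, taylorList, List.map_map]
  rfl

lemma coeff_one_flowSeries {F : PowerSeries (Polynomial 𝔸)} (hF : IsGraded F) :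
    PowerSeries.coeff 1 (flowSeries F) = topCoeff F 0 := by
  simpa [flowSeries, globalCoeff_zero] using coeff_globalCoeff_self hF 0

lemma coeff_two_flowSeries {F : PowerSeries (Polynomial 𝔸)} (hF : IsGraded F) :
    PowerSeries.coeff 2 (flowSeries F)
      = (2 : ℝ)⁻¹ • (topCoeff F 1 + topCoeff F 0 * topCoeff F 0) := by
  have h := coeff_globalCoeff_self hF 1
  have h1 := coeff_one_flowSeries hF
  simp only [flowSeries, PowerSeries.coeff_mk] at h1 ⊢
  rw [Finset.sum_range_succ, Finset.sum_range_one, h1] at h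
  simp only [globalCoeff_zero, Polynomial.coeff_one_zero, mul_one, Nat.sub_self, Nat.sub_zero] at h
  rw [← h, smul_smul]
  norm_num

variable {U : ℝ → ℝ → 𝔸} (hU0 : ∀ s ∈ Icc α β, U s s = 1)
  (hU : ∀ s ∈ Icc α β, ∀ t ∈ Icc α β,
    HasDerivWithinAt (fun τ => U τ s) (A t * U t s) (Icc α β) t)

-- The formula with the single generator `A` already has the right top coefficients, so its flow
-- series expands the propagator without any information on `V`.
include hs hA hU0 hU in
lemma exists_hasExpansion_propagator : ∃ F : PowerSeries (Polynomial 𝔸), IsGraded F ∧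
    (∀ n, topCoeff F n = PowerSeries.coeff n (taylorSeries A (Icc α β) s)) ∧
    HasExpansion (germ (Icc α β) s) (fun h => U (s + h) s) (flowSeries F) := by
  have htop : ∀ n, topCoeff (baseSeries (taylorList [(A, 0)] (Icc α β) s)) n
      = PowerSeries.coeff n (taylorSeries A (Icc α β) s) := fun n => by
    simp [topCoeff_baseSeries_taylorList]
  exact ⟨_, isGraded_baseSeries _, htop, hasExpansion_flowSeries (u := fun τ => U τ s) hA hs (hU0 s hs) (hU s hs)
    (isGraded_baseSeries _) htop⟩

variable [CompleteSpace 𝔸] {L : List ((ℝ → 𝔸) × ℝ)}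
  (hL : ∀ p ∈ L, ContDiffOn ℝ ∞ p.1 (Icc α β) ∧ p.2 ∈ Icc (0 : ℝ) 1)
  {V : ℝ → ℝ → 𝔸} (hV : ∀ t ∈ Icc α β, ∀ s ∈ Icc α β, V t s = productStep L t s)
  (hαβ : α < β)

include hs hL hV in
lemma hasExpansion_productFormula :
    HasExpansion (germ (Icc α β) s) (fun h => V (s + h) s)
      (evalSeries 0 (baseSeries (taylorList L (Icc α β) s))) := by
  refine (hasExpansion_productStep hL hs le_rfl).congr ?_
  filter_upwards [eventually_germ_mem hs zero_le_one] with h hh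
  rw [one_mul] at hh
  rw [hV _ hh _ hs]
  simp

variable (hO : ∀ s ∈ Icc α β,
  (fun h => V (s + h) s - U (s + h) s) =O[germ (Icc α β) s] fun h => h ^ 3)

include hA hs hL hV hU0 hU hαβ hO

/-- The generators of a consistent product formula sum up to the generator of the propagator. -/
lemma sum_generators : (L.map fun p => p.1 s).sum = A s := by
  have := germ_neBot hαβ hs
  obtain ⟨F, hF, htop, hexp⟩ := exists_hasExpansion_propagator hA hs hU0 hU
  have h := (hasExpansion_productFormula hs hL hV).coeff_eq (germ_le _ _) hexp (hO s hs) 1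
    (by norm_num)
  rw [coeff_one_flowSeries hF, htop, coeff_zero_taylorSeries, coeff_evalSeries, evalAt_zero] at h
  rw [← h]
  refine Eq.trans ?_ (topCoeff_baseSeries_taylorList L (Icc α β) s 0).symm
  simp [coeff_zero_taylorSeries]

/-- By `sum_generators` at every point of the interval, the sum of the generators and `A` agree as
functions there, hence in all Taylor coefficients at `s`. -/
lemma topCoeff_baseSeries_eq (n : ℕ) : topCoeff (baseSeries (taylorList L (Icc α β) s)) n
    = PowerSeries.coeff n (taylorSeries A (Icc α β) s) := by
  have := germ_neBot hαβ hs
  have h := HasExpansion.list_sum L fun p hp => hasExpansion_taylorSeries (hL p hp).1 hs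
  rw [← HasExpansion.unique (germ_le _ _) (h.congr ?_) (hasExpansion_taylorSeries hA hs),
    topCoeff_baseSeries_taylorList, map_list_sum, List.map_map]
  · rfl
  · filter_upwards [eventually_germ_mem hs zero_le_one] with x hx
    rw [one_mul] at hx
    exact sum_generators hA hx hU0 hU hL hV hαβ hO

variable (hinv : ∀ t ∈ Icc α β, ∀ s ∈ Icc α β, V s t * V t s = 1)
  [StarRing 𝔸] [NormedStarGroup 𝔸] [StarModule ℝ 𝔸]
  (hstar : ∀ t ∈ Icc α β, ∀ s ∈ Icc α β, star (V t s) = V s t)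
  {M : ℕ} (hM : 1 ≤ M) {a : Fin M → ℝ} {k : Fin M → ℕ} (hk : ∀ j, 1 ≤ k j)
  (hak : VandermondeSystem a k)

include hinv hstar hM hk hak in
theorem multiproduct_isBigO :
    ((fun h => (∑ j, a j • stepProd V s (k j) ((k j : ℝ)⁻¹ * h)) - U (s + h) s)
      =O[germ (Icc α β) s] fun h => h ^ (2 * M + 1)) ∧
    ((fun h => star (∑ j, a j • stepProd V s (k j) ((k j : ℝ)⁻¹ * h))
        * (∑ j, a j • stepProd V s (k j) ((k j : ℝ)⁻¹ * h)) - 1)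
      =O[germ (Icc α β) s] fun h => h ^ (2 * M + 2)) := by
  have hl := germ_le (Icc α β) s
  set F := baseSeries (taylorList L (Icc α β) s) with hFdef
  have hF0 : PowerSeries.coeff 0 F = 1 := coeff_zero_baseSeries _
  have hgr : IsGraded F := isGraded_baseSeries _
  have hpar : ∀ n i, Odd (n + i) → (globalCoeff F n).coeff i = 0 := fun n i h =>
    coeff_globalCoeff_eq_zero hF0 (evalSeries_mul_scale_evalSeries hL hs hV hαβ hinv) h
  have hun := fun n (hn : n ≠ 0) =>
    star_globalCoeff hgr (starSeries_evalSeries_mul hL hs hV hαβ hinv hstar) hn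
  have hW : HasExpansion (germ (Icc α β) s)
      (fun h => ∑ j, a j • stepProd V s (k j) ((k j : ℝ)⁻¹ * h)) (multiSeries a k F) :=
    HasExpansion.sum fun j _ => ((hasExpansion_stepProd hL hs hV (k j)).comp_mul_left
      (tendsto_mul_germ hs (by positivity))).const_smul (a j)
  have hUexp := hasExpansion_flowSeries (u := fun τ => U τ s) hA hs (hU0 s hs) (hU s hs) hgr
    (topCoeff_baseSeries_eq hA hs hU0 hU hL hV hαβ hO)
  constructor
  · refine (hW.sub hUexp).isBigO_of_coeff_eq_zero fun i hi => ?_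
    rw [map_sub, coeff_multiSeries_of_le hM hk hak hgr hpar (by omega), flowSeries,
      PowerSeries.coeff_mk, sub_self]
  · exact ((hW.star.mul hl hW).sub HasExpansion.one).isBigO_of_coeff_eq_zero fun i hi =>
      coeff_star_multiSeries_mul hM hk hak hgr hpar hun hi

end Order

/-! ### The midpoint formula. -/

section Midpoint

open Asymptotics Filter Set

variable {α β s : ℝ} {𝔸 : Type*} [NormedRing 𝔸] [NormedAlgebra ℝ 𝔸] {A : ℝ → 𝔸}

lemma coeff_expOf_X_mul (T : PowerSeries 𝔸) :
    PowerSeries.coeff 1 (expOf (PowerSeries.X * T)) = PowerSeries.coeff 0 T ∧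
    PowerSeries.coeff 2 (expOf (PowerSeries.X * T)) = PowerSeries.coeff 1 T
      + (2 : ℝ)⁻¹ • (PowerSeries.coeff 0 T * PowerSeries.coeff 0 T) := by
  have h1 : PowerSeries.coeff 1 (PowerSeries.X * T) = PowerSeries.coeff 0 T :=
    PowerSeries.coeff_succ_X_mul 0 T
  have h2 : PowerSeries.coeff 2 (PowerSeries.X * T) = PowerSeries.coeff 1 T :=
    PowerSeries.coeff_succ_X_mul 1 T
  have h3 : PowerSeries.coeff 2 ((PowerSeries.X * T) ^ 2)
      = PowerSeries.coeff 0 T * PowerSeries.coeff 0 T := by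
    rw [(PowerSeries.commute_X T).symm.mul_pow, PowerSeries.coeff_X_pow_mul', if_pos le_rfl, pow_two]
    simp
  constructor
  · simp [coeff_expOf, Finset.sum_range_succ, PowerSeries.coeff_one, h1]
  · simp [coeff_expOf, Finset.sum_range_succ, PowerSeries.coeff_one, h2, h3]

theorem midpoint_isBigO [CompleteSpace 𝔸] (hA : ContDiffOn ℝ ∞ A (Icc α β)) (hs : s ∈ Icc α β)
    {U : ℝ → ℝ → 𝔸} (hU0 : ∀ s ∈ Icc α β, U s s = 1)
    (hU : ∀ s ∈ Icc α β, ∀ t ∈ Icc α β,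
      HasDerivWithinAt (fun τ => U τ s) (A t * U t s) (Icc α β) t) :
    (fun h => productStep [(A, 1 / 2)] (s + h) s - U (s + h) s)
      =O[germ (Icc α β) s] fun h => h ^ 3 := by
  obtain ⟨F, hF, htop, hexp⟩ := exists_hasExpansion_propagator hA hs hU0 hU
  have hV := hasExpansion_productFormula (L := [(A, 1 / 2)]) (V := productStep [(A, 1 / 2)]) hs
    (fun p hp => by
      rw [List.mem_singleton.1 hp]
      exact ⟨hA, by norm_num, by norm_num⟩) fun _ _ _ _ => rfl
  have hser : evalSeries 0 (baseSeries (taylorList [(A, 1 / 2)] (Icc α β) s))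
      = expOf (PowerSeries.X * scale (1 / 2) (taylorSeries A (Icc α β) s)) := by
    simp [evalSeries_baseSeries, taylorList]
  rw [hser] at hV
  refine (hV.sub hexp).isBigO_of_coeff_eq_zero fun i hi => ?_
  obtain ⟨h1, h2⟩ := coeff_expOf_X_mul (scale (1 / 2) (taylorSeries A (Icc α β) s))
  rw [map_sub, sub_eq_zero]
  interval_cases i
  · rw [coeff_zero_expOf]
    simp [flowSeries, globalCoeff_zero]
  · rw [h1, coeff_one_flowSeries hF, htop, coeff_scale, pow_zero, one_smul]
  -- Here θ = 1/2 is needed: it gives the first Taylor coefficient of `A` the weight 1/2 that it has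
  -- in the flow.
  · rw [h2, coeff_two_flowSeries hF, htop, htop, coeff_scale, coeff_scale, smul_add]
    simp

end Midpoint

/-! ### Specialization to Hermitian matrix generators. -/

section Matrix

open Asymptotics Filter Set

variable {ι : Type*} [Fintype ι] [DecidableEq ι]

lemma stepExp_eq (G : ℝ → Matrix ι ι ℂ) (θ t s : ℝ) :
    stepExp G θ t s = NormedSpace.exp ((t - s) • (-Complex.I • G (s + θ * (t - s)))) := by
  rw [stepExp]
  congr 1
  ext i j
  simp only [Matrix.smul_apply, smul_eq_mul, Complex.real_smul]
  ring

lemma stepExp_mem_unitary {G : ℝ → Matrix ι ι ℂ} {θ t s : ℝ}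
    (hG : (G (s + θ * (t - s))).IsHermitian) : stepExp G θ t s ∈ unitary (Matrix ι ι ℂ) := by
  let _ : NormedAlgebra ℚ (Matrix ι ι ℂ) := NormedAlgebra.restrictScalars ℚ ℂ _
  refine NormedSpace.exp_mem_unitary_of_mem_skewAdjoint ?_
  rw [skewAdjoint.mem_iff, star_smul, Matrix.star_eq_conjTranspose, hG.eq, ← neg_smul]
  congr 1
  simp

lemma add_mul_sub_mem_Icc {α β s t θ : ℝ} (ht : t ∈ Icc α β) (hs : s ∈ Icc α β)
    (hθ : θ ∈ Icc (0 : ℝ) 1) : s + θ * (t - s) ∈ Icc α β := by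
  have := (convex_Icc α β).add_smul_sub_mem hs ht hθ
  simpa using this

lemma iterate_eq_stepProd (V : ℝ → ℝ → Matrix ι ι ℂ) (k : ℕ) (s h : ℝ) :
    iterate V k (s + h) s = stepProd V s k ((k : ℝ)⁻¹ * h) := by
  rw [iterate, stepProd]
  congr 2
  refine List.map_congr_left fun q _ => ?_
  congr 1
  · push_cast
    ring
  · ring

lemma isOrderFormula_iff {α β : ℝ} {n : ℕ} {U V : ℝ → ℝ → Matrix ι ι ℂ} :
    IsOrderFormula n (Icc α β) U V ↔ ∀ s ∈ Icc α β,
      (fun h => V (s + h) s - U (s + h) s) =O[germ (Icc α β) s] fun h => h ^ (n + 1) := by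
  refine forall₂_congr fun s _ => ⟨fun h => ?_, fun h => ?_⟩
  · refine ((isBigO_norm_left.1 h).comp_tendsto (tendsto_add_germ _ _)).congr (fun x => rfl)
      fun x => ?_
    simp
  · refine (h.comp_tendsto (tendsto_sub_germ _ _)).norm_left.congr (fun x => ?_) fun x => rfl
    simp

end Matrix

end Multiproduct

/-! ### The theorem. -/

open Multiproduct in
theorem mainTheorem8 {ι : Type*} [Fintype ι] [DecidableEq ι]
    (α β : ℝ) (hαβ : α < β)
    (H : ℝ → Matrix ι ι ℂ) (hH : ContDiffOn ℝ ∞ H (Set.Icc α β))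
    (hHerm : ∀ t ∈ Set.Icc α β, (H t).IsHermitian)
    (U : ℝ → ℝ → Matrix ι ι ℂ) (hU : Multiproduct.IsPropagator (Set.Icc α β) H U)
    (M : ℕ) (hM : 1 ≤ M) (a : Fin M → ℝ) (k : Fin M → ℕ) (hk : ∀ j, 1 ≤ k j)
    (hak : Multiproduct.VandermondeSystem a k) :
    Multiproduct.IsBaseFormula (Set.Icc α β) U (Multiproduct.midpointFormula H) ∧
    ∀ U₂ : ℝ → ℝ → Matrix ι ι ℂ, Multiproduct.IsBaseFormula (Set.Icc α β) U U₂ →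
      Multiproduct.IsOrderFormula (2 * M) (Set.Icc α β) U (Multiproduct.multiproduct a k U₂) ∧
      ∀ t₀ ∈ Set.Icc α β,
        (fun t => ‖(Multiproduct.multiproduct a k U₂ t t₀)ᴴ * Multiproduct.multiproduct a k U₂ t t₀
            - 1‖) =O[𝓝[Set.Icc α β] t₀] fun t => (t - t₀) ^ (2 * M + 2) := by
  have hA : ∀ G : ℝ → Matrix ι ι ℂ, ContDiffOn ℝ ∞ G (Set.Icc α β) →
      ContDiffOn ℝ ∞ (fun t => -Complex.I • G t) (Set.Icc α β) := fun G hG => hG.const_smul _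
  have hU0 : ∀ s ∈ Set.Icc α β, U s s = 1 := fun s hs => (hU s hs).1
  have hU1 : ∀ s ∈ Set.Icc α β, ∀ t ∈ Set.Icc α β, HasDerivWithinAt (fun τ => U τ s)
      ((-Complex.I • H t) * U t s) (Set.Icc α β) t := fun s hs t ht => by
    rw [smul_mul_assoc]
    exact (hU s hs).2 t ht
  have hmid : ∀ t s, midpointFormula H t s = stepExp H (1 / 2) t s := fun t s => by
    rw [midpointFormula, stepExp]
    congr 3
    ring
  refine ⟨⟨⟨[(H, 1 / 2)], ?_, ?_⟩, ?_, ?_⟩, fun U₂ hU₂ => ?_⟩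
  · intro p hp
    rw [List.mem_singleton.1 hp]
    exact ⟨hH, hHerm, by norm_num, by norm_num⟩
  · intro t _ s _
    simp [hmid]
  · intro t ht s hs
    have hm : (s + t) / 2 ∈ Set.Icc α β := ⟨by linarith [ht.1, hs.1], by linarith [ht.2, hs.2]⟩
    rw [midpointFormula, midpointFormula, ← Matrix.exp_conjTranspose, Matrix.conjTranspose_smul,
      (hHerm _ hm).eq, add_comm t s]
    congr 2
    simp
    ring
  · refine isOrderFormula_iff.2 fun s hs => ?_
    refine (midpoint_isBigO (hA H hH) hs hU0 hU1).congr_left fun h => ?_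
    rw [hmid, stepExp_eq]
    simp [productStep]
  · obtain ⟨⟨L, hL, hLV⟩, hsym, hord⟩ := hU₂
    have hV : ∀ t ∈ Set.Icc α β, ∀ s ∈ Set.Icc α β,
        U₂ t s = productStep (L.map fun p => ((fun t => -Complex.I • p.1 t), p.2)) t s := by
      intro t ht s hs
      rw [hLV t ht s hs, productStep, List.map_map]
      congr 1
      exact List.map_congr_left fun p _ => stepExp_eq _ _ _ _
    have hL' : ∀ p ∈ L.map (fun p => ((fun t => -Complex.I • p.1 t), p.2)),
        ContDiffOn ℝ ∞ p.1 (Set.Icc α β) ∧ p.2 ∈ Set.Icc (0 : ℝ) 1 := by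
      intro p hp
      obtain ⟨g, hg, rfl⟩ := List.mem_map.1 hp
      exact ⟨hA _ (hL g hg).1, (hL g hg).2.2⟩
    -- Each exponential is unitary, so symmetry turns time reversal into inversion.
    have hinv : ∀ t ∈ Set.Icc α β, ∀ s ∈ Set.Icc α β, U₂ s t * U₂ t s = 1 := by
      intro t ht s hs
      have hun : U₂ t s ∈ unitary (Matrix ι ι ℂ) := by
        rw [hLV t ht s hs]
        refine list_prod_mem fun x hx => ?_
        obtain ⟨p, hp, rfl⟩ := List.mem_map.1 hx
        exact stepExp_mem_unitary ((hL p hp).2.1 _ (add_mul_sub_mem_Icc ht hs (hL p hp).2.2))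
      rw [← hsym t ht s hs]
      exact Unitary.star_mul_self_of_mem hun
    have hmulti : ∀ s h, multiproduct a k U₂ (s + h) s
        = ∑ j, a j • stepProd U₂ s (k j) ((k j : ℝ)⁻¹ * h) := fun s h => by
      simp only [multiproduct, iterate_eq_stepProd, Complex.coe_smul]
    have hmain := fun s (hs : s ∈ Set.Icc α β) => multiproduct_isBigO (hA H hH) hs hU0 hU1 hL' hV hαβ
      (isOrderFormula_iff.1 hord) hinv hsym hM hk hak
    refine ⟨isOrderFormula_iff.2 fun s hs => ?_, fun s hs => ?_⟩
    · simp only [hmulti]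
      exact (hmain s hs).1
    · refine ((hmain s hs).2.comp_tendsto (tendsto_sub_germ _ _)).norm_left.congr_left fun t => ?_
      simp only [Function.comp_apply, ← hmulti, add_sub_cancel, Matrix.star_eq_conjTranspose]
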